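/- **Conventions.** $\mathbb N=\{0,1,2,\dots\}$. A multigraph $G$ is finite, undirected and loopless: a finite vertex set $V(G)$ with an edge-weight function $\omega_G\colon\binom{V(G)}{2}\to\mathbb N$; $E(G)$ is the multiset containing $\omega_G(e)$ copies of each $e$, and $\#E(G)=\sum_e\omega_G(e)$. All multigraphs contain the root $0$, and $\widetilde V(G)=V(G)\setminus\{0\}$. For $U\subseteq\widetilde V(G)$ and $i\in U$ put $\deg^G_U(i)=\sum_{j\in V(G)\setminus U}\omega_G(\{i,j\})$. $G$ is connected if every $\varnothing\ne U\subseteq\widetilde V(G)$ has an $i\in U$ with $\deg^G_U(i)\ge1$. A tree is a connected multigraph $T$ with $\#E(T)=\#V(T)-1$; it is a spanning tree of $G$ if $V(T)=V(G)$ and $\omega_T\le\omega_G$. For a tree $T$, write $i\le_T j$ if the path in $T$ from $j$ to $0$ passes through $i$, and let $\mathrm{par}_T(j)$ be the parent of $j\neq 0$. Let $G$ be a connected multigraph with $V(G)=\{0,1,\dots,n\}$ and root $0$, and let $\prec$ be any total order on $\widetilde V(G)$. A $G$-parking function is an $\alpha\in\mathbb N^{\widetilde V(G)}$ such that every $\varnothing\ne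 U\subseteq\widetilde V(G)$ has an $i\in U$ with $\alpha_i\le\deg^G_U(i)-1$; $\mathrm{PF}(G)$ is the set of these. Put $\mathrm{rsum}(\alpha)=\#E(G)-n-\sum_i\alpha_i$ and, for a spanning tree $T$ of $G$, $$\kappa(G,T,\prec)=\sum_{\substack{i,j\in\widetilde V(G)\\ i\le_T j,\ j\prec i}}\omega_G(\{\mathrm{par}_T(i),j\}).$$ **Algorithm 1** (multigraph DFS-burning; input $\alpha\in\mathbb N^{\widetilde V(G)}$). Start with $B=\{0\}$ (burning vertices), no burnt edges, $V(T)=\{0\}$, $E(T)=\varnothing$, $\ell$ empty, $h=0$. (1) For all $j\in V(G)\setminus B$ from the $\prec$-largest to the $\prec$-smallest, and for each unburnt copy $e\in E(G)$ of $\{h,j\}$: if $\alpha_j\ge1$, burn $e$ and decrease $\alpha_j$ by $1$; otherwise add $j$ to $B$ and to $V(T)$, add $e$ to $E(T)$, let $\ell(e)$ be the number of unburnt copies of $\{h,j\}$ in $E(G)$ other than $e$, set $h:=j$, and restart (1). (2) When the loops of (1) end without a restart: if $h\ne0$, set $h:=\mathrm{par}_T(h)$ and go to (1); otherwise output $(T,\ell)$.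 **Algorithm 2** (input: a spanning tree $T$ of $G$ and $\ell\colon E(T)\to\mathbb N$). Start with $B=\{0\}$, no burnt edges, $\alpha=(0,\dots,0)$, $h=0$. (1) For all $j\in V(G)\setminus B$ from the $\prec$-largest to the $\prec$-smallest, and for each unburnt copy $e\in E(G)$ of $\{h,j\}$: if $\{h,j\}\in E(T)$ and $\ell(\{h,j\})$ equals the number of unburnt copies of $\{h,j\}$ in $E(G)$ other than $e$, add $j$ to $B$, set $h:=j$, and restart (1); otherwise burn $e$ and increase $\alpha_j$ by $1$. (2) When the loops of (1) end without a restart: if $h\ne0$, set $h:=\mathrm{par}_T(h)$ and go to (1); otherwise output $\alpha$. **Theorem.** (a) Algorithm 1 halts on every $\alpha\in\mathbb N^{\widetilde V(G)}$. Let $(T,\ell)$ be its output. If $V(T)=V(G)$, then $\alpha\in\mathrm{PF}(G)$. If $V(T)\ne V(G)$, then the nonempty set $U=V(G)\setminus V(T)\subseteq\widetilde V(G)$ certifies that $\alpha\notin\mathrm{PF}(G)$: $\alpha_j\ge\deg^G_U(j)$ for all $j\in U$. (b) Sending $\alpha\in\mathrm{PF}(G)$ to the output of Algorithm 1 on $\alpha$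 is a bijection $$\varphi^{\prec}\colon\mathrm{PF}(G)\to\{(T,\ell): T\text{ a spanning tree of }G,\ \ell\colon E(T)\to\mathbb N,\ \ell(e)\in\{0,\dots,\omega_G(e)-1\}\text{ for all }e\in E(T)\}.$$ If $\varphi^{\prec}(\alpha)=(T,\ell)$, then $\mathrm{rsum}(\alpha)=\kappa(G,T,\prec)+\sum_{e\in E(T)}\ell(e)$. The inverse of $\varphi^{\prec}$ is given by Algorithm 2: on every $(T,\ell)$ of the set above it halts, with output $(\varphi^{\prec})^{-1}(T,\ell)$. -/

import Mathlib

/-- The non-root vertices of the vertex set `{0, 1, …, n}` with root `0`. (A `def`, so that it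
does not inherit the usual order of `Fin (n + 1)`: a total order on it is a free parameter.) -/
def NonRoot (n : ℕ) : Type := {i : Fin (n + 1) // i ≠ 0}

instance NonRoot.instFintype (n : ℕ) : Fintype (NonRoot n) :=
  inferInstanceAs (Fintype {i : Fin (n + 1) // i ≠ 0})

/-- The underlying vertex in `{0, 1, …, n}` of a non-root vertex. -/
def NonRoot.val {n : ℕ} (i : NonRoot n) : Fin (n + 1) := Subtype.val i

/-- A finite undirected loopless multigraph whose vertex set `verts` is a subset of
`{0, 1, …, n}` that contains the root `0`; `weight s(i, j)` is the number of edges between `i`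
and `j`. -/
@[ext]
structure Multigraph (n : ℕ) where
  verts : Finset (Fin (n + 1))
  root_mem : 0 ∈ verts
  weight : Sym2 (Fin (n + 1)) → ℕ
  loopless : ∀ i, weight s(i, i) = 0
  incident : ∀ i j, weight s(i, j) ≠ 0 → i ∈ verts

namespace Multigraph

variable {n : ℕ}

/-- The number of edges, counted with multiplicity. -/
def numEdges (G : Multigraph n) : ℕ := ∑ e, G.weight e

/-- The set of edges, without multiplicity. -/
def edges (G : Multigraph n) : Finset (Sym2 (Fin (n + 1))) :=
  Finset.univ.filter fun e => G.weight e ≠ 0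

/-- `G.deg U i` is the number of edges of `G` that join `i` to a vertex outside `U`. -/
def deg (G : Multigraph n) (U : Finset (Fin (n + 1))) (i : Fin (n + 1)) : ℕ :=
  ∑ j ∈ G.verts \ U, G.weight s(i, j)

/-- Every nonempty set of non-root vertices has a member that is joined to its complement. -/
def Connected (G : Multigraph n) : Prop :=
  ∀ U : Finset (Fin (n + 1)), U.Nonempty → U ⊆ G.verts → 0 ∉ U → ∃ i ∈ U, 1 ≤ G.deg U i

/-- A tree is a connected multigraph with one edge less than vertices. -/
def IsTree (T : Multigraph n) : Prop :=
  T.Connected ∧ T.numEdges + 1 = T.verts.card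

/-- `T` is a spanning tree of `G`: a tree with the vertices of `G` and some of its edges. -/
def IsSpanningTree (G T : Multigraph n) : Prop :=
  T.verts = G.verts ∧ (∀ e, T.weight e ≤ G.weight e) ∧ T.IsTree

/-- The simple graph of adjacent vertices. -/
def toSimpleGraph (T : Multigraph n) : SimpleGraph (Fin (n + 1)) where
  Adj i j := T.weight s(i, j) ≠ 0
  symm := ⟨fun i j h => by rwa [Sym2.eq_swap]⟩
  loopless := ⟨fun i h => h (T.loopless i)⟩

/-- The tree order `i ≤_T j`: the path in `T` from `j` to the root passes through `i`. -/
def TreeLE (T : Multigraph n) (i j : Fin (n + 1)) : Prop :=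
  ∃ p : T.toSimpleGraph.Walk j 0, p.IsPath ∧ i ∈ p.support

/-- `i` is an ancestor of `j` (and `j` is a descendant of `i`). -/
def IsAncestor (T : Multigraph n) (i j : Fin (n + 1)) : Prop :=
  T.TreeLE i j ∧ i ≠ j

/-- `i` is a parent of `j`: `j` is a descendant of `i`, and no descendant of `i` is an ancestor
of `j`. -/
def IsParent (T : Multigraph n) (i j : Fin (n + 1)) : Prop :=
  T.IsAncestor i j ∧ ∀ k, ¬ (T.IsAncestor i k ∧ T.IsAncestor k j)

open Classical in
/-- The parent of `j` in `T` (with the value `0` if there is none). -/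
noncomputable def par (T : Multigraph n) (j : Fin (n + 1)) : Fin (n + 1) :=
  if h : ∃ i, T.IsParent i j then h.choose else 0

/-- The set of `G`-parking functions, for `G` with vertex set `{0, 1, …, n}`. -/
def PF (G : Multigraph n) : Set (NonRoot n → ℕ) :=
  {α | ∀ U : Finset (Fin (n + 1)), U.Nonempty → U ⊆ G.verts → 0 ∉ U →
    ∃ i : NonRoot n, i.val ∈ U ∧ α i + 1 ≤ G.deg U i.val}

/-- The reversed sum of `α`, for `G` with vertex set `{0, 1, …, n}`. -/
def rsum (G : Multigraph n) (α : NonRoot n → ℕ) : ℤ :=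
  (G.numEdges : ℤ) - n - ∑ i, (α i : ℤ)

/-- Pairs `(T, ℓ)` of a spanning tree `T` of `G` and a labeling `ℓ` of its edges with
`ℓ e ∈ {0, …, weight e - 1}`. A function on the edges of `T` is represented by its extension by
zero to all pairs of vertices. -/
def labeledSpanningTrees (G : Multigraph n) :
    Set (Multigraph n × (Sym2 (Fin (n + 1)) → ℕ)) :=
  {p | G.IsSpanningTree p.1 ∧ (∀ e ∈ p.1.edges, p.2 e < G.weight e) ∧
    ∀ e ∉ p.1.edges, p.2 e = 0}

open Classical in
/-- The number `κ(G, T, ≺)`, where `≺` is the order of `NonRoot n`. -/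
noncomputable def kappa (G T : Multigraph n) [LinearOrder (NonRoot n)] : ℕ :=
  ∑ p ∈ (Finset.univ : Finset (NonRoot n × NonRoot n)).filter
      (fun p => T.TreeLE p.1.val p.2.val ∧ p.2 < p.1),
    G.weight s(T.par p.1.val, p.2.val)

/-- The multigraph with vertex set `{0}` and no edges. -/
def single (n : ℕ) : Multigraph n where
  verts := {0}
  root_mem := by simp
  weight := fun _ => 0
  loopless := fun _ => rfl
  incident := fun _ _ h => absurd rfl h

/-- Add the vertices `u`, `v` to `T` and, if `u ≠ v`, one edge between them. -/
def addEdge (T : Multigraph n) (u v : Fin (n + 1)) : Multigraph n where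
  verts := insert u (insert v T.verts)
  root_mem := by simp [T.root_mem]
  weight := fun e => T.weight e + if e = s(u, v) ∧ u ≠ v then 1 else 0
  loopless := fun i => by
    have h : ¬ (s(i, i) = s(u, v) ∧ u ≠ v) := by
      rintro ⟨h, huv⟩
      rcases Sym2.eq_iff.1 h with ⟨h1, h2⟩ | ⟨h1, h2⟩
      · exact huv (h1.symm.trans h2)
      · exact huv (h2.symm.trans h1)
    simp only [if_neg h, T.loopless i]
  incident := fun i j h => by
    by_cases hT : T.weight s(i, j) = 0
    · by_cases he : s(i, j) = s(u, v) ∧ u ≠ v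
      · rcases Sym2.eq_iff.1 he.1 with ⟨h1, -⟩ | ⟨h1, -⟩ <;> simp [h1]
      · exact absurd (by simp only [if_neg he, hT]) h
    · simp [T.incident i j hT]

/-! ### The multigraph DFS-burning algorithm -/

/-- The variables of the burning algorithm. `burnt e` is the number of burnt copies of `e`, and
`chips` is the current value of `α`. -/
structure BurnState (n : ℕ) where
  burning : Finset (Fin (n + 1))
  burnt : Sym2 (Fin (n + 1)) → ℕ
  T : Multigraph n
  label : Sym2 (Fin (n + 1)) → ℕ
  head : Fin (n + 1)
  chips : NonRoot n → ℕ

/-- The initial state on input `α`. -/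
def burnInit (α : NonRoot n → ℕ) : BurnState n where
  burning := {0}
  burnt := fun _ => 0
  T := single n
  label := fun _ => 0
  head := 0
  chips := α

/-- The vertices of `G` that are not in `burning`, from max to min. -/
def scanList (G : Multigraph n) [LinearOrder (NonRoot n)] (burning : Finset (Fin (n + 1))) :
    List (NonRoot n) :=
  (Finset.univ.filter fun j : NonRoot n => j.val ∈ G.verts \ burning).sort (fun a b => b ≤ a)

/-- The inner loop, over the `k` remaining copies of the edge `{head, j}`. The Boolean tells
whether a new vertex started to burn, that is, whether the loops are left by `break`. -/
def burnEdgeLoop (G : Multigraph n) [LinearOrder (NonRoot n)] (j : NonRoot n) :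
    ℕ → BurnState n → BurnState n × Bool
  | 0, s => (s, false)
  | k + 1, s =>
    if 1 ≤ s.chips j then
      burnEdgeLoop G j k
        { s with
          burnt := Function.update s.burnt s(s.head, j.val) (s.burnt s(s.head, j.val) + 1)
          chips := Function.update s.chips j (s.chips j - 1) }
    else
      ({ burning := insert j.val s.burning
         burnt := s.burnt
         T := s.T.addEdge s.head j.val
         label := Function.update s.label s(s.head, j.val)
           (G.weight s(s.head, j.val) - (s.burnt s(s.head, j.val) + 1))
         head := j.val
         chips := s.chips }, true)

/-- The outer loop, over the given list of vertices. -/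
def burnVertexLoop (G : Multigraph n) [LinearOrder (NonRoot n)] :
    List (NonRoot n) → BurnState n → BurnState n × Bool
  | [], s => (s, false)
  | j :: js, s =>
    let r := burnEdgeLoop G j (G.weight s(s.head, j.val) - s.burnt s(s.head, j.val)) s
    if r.2 then r else burnVertexLoop G js r.1

/-- One pass of the outer loop and the following backtracking instruction, up to the next `goto`
(`Sum.inr`, with the new state) or to the output `(T, ℓ)` (`Sum.inl`). -/
noncomputable def burnStep (G : Multigraph n) [LinearOrder (NonRoot n)] (s : BurnState n) :
    (Multigraph n × (Sym2 (Fin (n + 1)) → ℕ)) ⊕ BurnState n :=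
  let r := burnVertexLoop G (G.scanList s.burning) s
  if r.2 then Sum.inr r.1
  else if r.1.head ≠ 0 then Sum.inr { r.1 with head := r.1.T.par r.1.head }
  else Sum.inl (r.1.T, r.1.label)

/-- The multigraph DFS-burning algorithm: its output `(T, ℓ)` on input `α`, which is defined if
and only if the iteration of `burnStep` halts. -/
noncomputable def dfsBurn (G : Multigraph n) [LinearOrder (NonRoot n)] (α : NonRoot n → ℕ) :
    Part (Multigraph n × (Sym2 (Fin (n + 1)) → ℕ)) :=
  PFun.fix (fun s => Part.some (G.burnStep s)) (burnInit α)

/-! ### The inverse algorithm -/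

/-- The variables of the inverse algorithm; `chips` is the current value of `α`. -/
structure UnburnState (n : ℕ) where
  burning : Finset (Fin (n + 1))
  burnt : Sym2 (Fin (n + 1)) → ℕ
  chips : NonRoot n → ℕ
  head : Fin (n + 1)

/-- The initial state. -/
def unburnInit (n : ℕ) : UnburnState n where
  burning := {0}
  burnt := fun _ => 0
  chips := fun _ => 0
  head := 0

/-- The inner loop, over the `k` remaining copies of the edge `{head, j}`. -/
def unburnEdgeLoop (G : Multigraph n) [LinearOrder (NonRoot n)]
    (T : Multigraph n) (label : Sym2 (Fin (n + 1)) → ℕ) (j : NonRoot n) :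
    ℕ → UnburnState n → UnburnState n × Bool
  | 0, s => (s, false)
  | k + 1, s =>
    if s(s.head, j.val) ∈ T.edges ∧ label s(s.head, j.val) =
        G.weight s(s.head, j.val) - (s.burnt s(s.head, j.val) + 1) then
      ({ s with
         burning := insert j.val s.burning
         head := j.val }, true)
    else
      unburnEdgeLoop G T label j k
        { s with
          burnt := Function.update s.burnt s(s.head, j.val) (s.burnt s(s.head, j.val) + 1)
          chips := Function.update s.chips j (s.chips j + 1) }

/-- The outer loop, over the given list of vertices. -/
def unburnVertexLoop (G : Multigraph n) [LinearOrder (NonRoot n)]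
    (T : Multigraph n) (label : Sym2 (Fin (n + 1)) → ℕ) :
    List (NonRoot n) → UnburnState n → UnburnState n × Bool
  | [], s => (s, false)
  | j :: js, s =>
    let r := unburnEdgeLoop G T label j
      (G.weight s(s.head, j.val) - s.burnt s(s.head, j.val)) s
    if r.2 then r else unburnVertexLoop G T label js r.1

/-- One pass of the outer loop and the following backtracking instruction, up to the next `goto`
(`Sum.inr`, with the new state) or to the output `α` (`Sum.inl`). -/
noncomputable def unburnStep (G : Multigraph n) [LinearOrder (NonRoot n)]
    (T : Multigraph n) (label : Sym2 (Fin (n + 1)) → ℕ) (s : UnburnState n) :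
    (NonRoot n → ℕ) ⊕ UnburnState n :=
  let r := unburnVertexLoop G T label (G.scanList s.burning) s
  if r.2 then Sum.inr r.1
  else if r.1.head ≠ 0 then Sum.inr { r.1 with head := T.par r.1.head }
  else Sum.inl r.1.chips

/-- The inverse algorithm: its output `α` on input `(T, ℓ)`, which is defined if and only if the
iteration of `unburnStep` halts. -/
noncomputable def dfsUnburn (G : Multigraph n) [LinearOrder (NonRoot n)]
    (p : Multigraph n × (Sym2 (Fin (n + 1)) → ℕ)) : Part (NonRoot n → ℕ) :=
  PFun.fix (fun s => Part.some (G.unburnStep p.1 p.2 s)) (unburnInit n)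

end Multigraph

/-! Both algorithms are runs of one deterministic machine. `Step G D` burns a copy of an edge,
ignites a vertex or backtracks, and the decision `D` alone says whether the next copy ignites its
end: `ByChips α` for the burning algorithm, `ByTree G T l` for its inverse. The state counts the
edges burnt into each vertex, so the input enters only through `D`. The actual programs simulate
this machine (`burnStep_remaining`, `unburnStep_toUnburn`), and since `potential` drops at every
step, they halt at its terminal state (`exists_terminal`), which determinism makes unique
(`Terminal.unique`).

When a vertex ignites, its chip count and the burnt copies between it and the other burning vertices
freeze (`Later`). Hence a run from the initial state to `t`, whoever made its decisions, is also a
run under `ByTree` for the tree and labels of `t` (`steps_byTree`) and under `ByChips` for the chips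
of `t` (`steps_byChips`). With uniqueness of the terminal state, each algorithm therefore undoes the
other.

The rest follows from invariants `Inv` that hold for every `D`. A vertex ignites while a copy of the
edge from the head is still unburnt, so the first vertex of `U` to burn certifies the parking
condition for `U`. If some vertices never burn, all edges into them from burning vertices are burnt
and have consumed that many chips. For the sum formula, let all vertices burn and count unburnt
copies. A tree edge retains its label plus one. Edges between incomparable vertices are entirely
burnt. If `i ≤_T j` and `i ≠ j`, the edge from the parent of `i` to `j` is entirely burnt when `i ≺
j`, and untouched when `j ≺ i`, because the scan at that parent runs downwards and descends at `i`.
The untouched edges are exactly those that `kappa` counts (`Inv.kappa_eq`). -/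

namespace Multigraph

variable {n : ℕ}

/-! ### Trees described by parent functions -/

/-- `Anc f i j`: iterating the parent function `f` from `j`, without leaving the root, leads
to `i`. -/
def Anc (f : Fin (n + 1) → Fin (n + 1)) (i j : Fin (n + 1)) : Prop :=
  Relation.ReflTransGen (fun a b => a ≠ 0 ∧ b = f a) j i

theorem Anc.refl (f : Fin (n + 1) → Fin (n + 1)) (i : Fin (n + 1)) : Anc f i i :=
  Relation.ReflTransGen.refl

theorem Anc.of_parent {f : Fin (n + 1) → Fin (n + 1)} {i j : Fin (n + 1)} (hj : j ≠ 0)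
    (h : Anc f i (f j)) : Anc f i j :=
  Relation.ReflTransGen.head ⟨hj, rfl⟩ h

theorem Anc.eq_or_parent {f : Fin (n + 1) → Fin (n + 1)} {i j : Fin (n + 1)} (h : Anc f i j) :
    i = j ∨ j ≠ 0 ∧ Anc f i (f j) := by
  rcases Relation.ReflTransGen.cases_head h with h | ⟨c, ⟨h0, rfl⟩, h⟩
  · exact Or.inl h.symm
  · exact Or.inr ⟨h0, h⟩

theorem Anc.eq_zero {f : Fin (n + 1) → Fin (n + 1)} {i : Fin (n + 1)} (h : Anc f i 0) :
    i = 0 := by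
  rcases h.eq_or_parent with h | h
  · exact h
  · exact absurd rfl h.1

theorem Anc.eq_or_child {f : Fin (n + 1) → Fin (n + 1)} {i j : Fin (n + 1)} (h : Anc f i j) :
    i = j ∨ ∃ k, k ≠ 0 ∧ f k = i ∧ Anc f k j := by
  rcases Relation.ReflTransGen.cases_tail h with h | ⟨c, h, h0, hc⟩
  · exact Or.inl h
  · exact Or.inr ⟨c, h0, hc.symm, h⟩

theorem Anc.total {f : Fin (n + 1) → Fin (n + 1)} {i j k : Fin (n + 1)} (hi : Anc f i k)
    (hj : Anc f j k) : Anc f i j ∨ Anc f j i := by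
  have hu : Relator.RightUnique (fun a b : Fin (n + 1) => a ≠ 0 ∧ b = f a) :=
    fun a b c hb hc => hb.2.trans hc.2.symm
  exact (Relation.ReflTransGen.total_of_right_unique hu hi hj).symm

open Classical in
/-- `f` maps each non-root vertex of `T` to a neighbour of smaller depth `d`, and `T` has no other
edges. -/
structure IsParentMap (T : Multigraph n) (f : Fin (n + 1) → Fin (n + 1))
    (d : Fin (n + 1) → ℕ) : Prop where
  mem : ∀ v ∈ T.verts, v ≠ 0 → f v ∈ T.verts
  depth : ∀ v ∈ T.verts, v ≠ 0 → d (f v) < d v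
  weight : ∀ e, T.weight e = if ∃ v ∈ T.verts, v ≠ 0 ∧ e = s(v, f v) then 1 else 0

namespace IsParentMap

variable {T : Multigraph n} {f : Fin (n + 1) → Fin (n + 1)} {d : Fin (n + 1) → ℕ}

theorem weight_ne_zero (hT : IsParentMap T f d) {e : Sym2 (Fin (n + 1))} :
    T.weight e ≠ 0 ↔ ∃ v ∈ T.verts, v ≠ 0 ∧ e = s(v, f v) := by
  rw [hT.weight e]
  split_ifs with h <;> simp [h]

theorem weight_parent (hT : IsParentMap T f d) {v : Fin (n + 1)} (hv : v ∈ T.verts)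
    (h0 : v ≠ 0) : T.weight s(v, f v) = 1 := by
  rw [hT.weight, if_pos ⟨v, hv, h0, rfl⟩]

theorem adj (hT : IsParentMap T f d) {i j : Fin (n + 1)} (h : T.weight s(i, j) ≠ 0) :
    (i ∈ T.verts ∧ i ≠ 0 ∧ j = f i) ∨ (j ∈ T.verts ∧ j ≠ 0 ∧ i = f j) := by
  obtain ⟨v, hv, h0, he⟩ := hT.weight_ne_zero.1 h
  rcases Sym2.eq_iff.1 he with ⟨rfl, rfl⟩ | ⟨rfl, rfl⟩
  · exact Or.inl ⟨hv, h0, rfl⟩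
  · exact Or.inr ⟨hv, h0, rfl⟩

theorem anc_mem_depth (hT : IsParentMap T f d) {i j : Fin (n + 1)} (hj : j ∈ T.verts)
    (h : Anc f i j) : i ∈ T.verts ∧ d i ≤ d j := by
  induction h with
  | refl => exact ⟨hj, le_rfl⟩
  | tail _ hbc ih =>
    obtain ⟨h0, rfl⟩ := hbc
    exact ⟨hT.mem _ ih.1 h0, (hT.depth _ ih.1 h0).le.trans ih.2⟩

theorem anc_mem (hT : IsParentMap T f d) {i j : Fin (n + 1)} (hj : j ∈ T.verts)
    (h : Anc f i j) : i ∈ T.verts := (hT.anc_mem_depth hj h).1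

theorem anc_depth (hT : IsParentMap T f d) {i j : Fin (n + 1)} (hj : j ∈ T.verts)
    (h : Anc f i j) : d i ≤ d j := (hT.anc_mem_depth hj h).2

/-- A step of a walk goes to the parent or to a child. Unless the walk is at `i` itself, `i` stays
an ancestor of the current vertex, so no walk to the root can avoid it. -/
theorem mem_support_of_anc (hT : IsParentMap T f d) {i k z : Fin (n + 1)} (hz : z = 0)
    (p : T.toSimpleGraph.Walk k z) (h : Anc f i k) : i ∈ p.support := by
  induction p with
  | nil => subst hz; simp [h.eq_zero]
  | @cons k m z hkm p ih =>
    rw [SimpleGraph.Walk.support_cons, List.mem_cons]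
    rcases h.eq_or_parent with h' | ⟨h0, h'⟩
    · exact Or.inl h'
    · right
      rcases hT.adj hkm with ⟨_, _, rfl⟩ | ⟨_, hm, rfl⟩
      · exact ih hz h'
      · exact ih hz (h.of_parent hm)

theorem anc_of_mem_support (hT : IsParentMap T f d) {i k z : Fin (n + 1)} (hz : z = 0)
    (p : T.toSimpleGraph.Walk k z) (hp : p.IsPath) (h : i ∈ p.support) : Anc f i k := by
  induction p with
  | nil =>
    rw [SimpleGraph.Walk.support_nil, List.mem_singleton] at h
    exact h ▸ Anc.refl f _
  | @cons k m z hkm p ih =>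
    rw [SimpleGraph.Walk.support_cons, List.mem_cons] at h
    rw [SimpleGraph.Walk.cons_isPath_iff] at hp
    rcases h with rfl | h
    · exact Anc.refl f _
    · rcases hT.adj hkm with ⟨_, h0, rfl⟩ | ⟨_, hm, rfl⟩
      · exact (ih hz hp.1 h).of_parent h0
      -- A step down to a child would force the rest of the walk to come back through its parent
      -- `k`, which a path cannot do.
      · exact absurd (hT.mem_support_of_anc hz p ((Anc.refl f _).of_parent hm)) hp.2

theorem reachable (hT : IsParentMap T f d) {v : Fin (n + 1)} (hv : v ∈ T.verts) :
    T.toSimpleGraph.Reachable v 0 := by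
  induction hd : d v using Nat.strong_induction_on generalizing v with
  | _ m ih =>
    by_cases h0 : v = 0
    · subst h0; rfl
    · have hadj : T.toSimpleGraph.Adj v (f v) := by
        change T.weight s(v, f v) ≠ 0
        rw [hT.weight_parent hv h0]
        exact one_ne_zero
      exact hadj.reachable.trans (ih _ (hd ▸ hT.depth v hv h0) (hT.mem v hv h0) rfl)

theorem treeLE_iff (hT : IsParentMap T f d) {i j : Fin (n + 1)} (hj : j ∈ T.verts) :
    T.TreeLE i j ↔ Anc f i j := by
  constructor
  · rintro ⟨p, hp, hi⟩
    exact hT.anc_of_mem_support rfl p hp hi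
  · intro h
    obtain ⟨p, hp⟩ := (hT.reachable hj).exists_isPath
    exact ⟨p, hp, hT.mem_support_of_anc rfl p h⟩

theorem isParent_iff (hT : IsParentMap T f d) {i j : Fin (n + 1)} (hj : j ∈ T.verts)
    (h0 : j ≠ 0) : T.IsParent i j ↔ i = f j := by
  have hd := hT.depth j hj h0
  have hfj : T.IsAncestor (f j) j :=
    ⟨(hT.treeLE_iff hj).2 ((Anc.refl f _).of_parent h0), fun h => by rw [h] at hd; omega⟩
  have key : ∀ k, T.IsAncestor k j → Anc f k (f j) := by
    rintro k ⟨hk, hkj⟩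
    rcases ((hT.treeLE_iff hj).1 hk).eq_or_parent with h | h
    · exact absurd h hkj
    · exact h.2
  constructor
  · rintro ⟨hij, hno⟩
    by_contra hne
    exact hno (f j) ⟨⟨(hT.treeLE_iff (hT.mem j hj h0)).2 (key i hij), hne⟩, hfj⟩
  · rintro rfl
    refine ⟨hfj, ?_⟩
    rintro k ⟨⟨h1, hne⟩, h2⟩
    have hk := key k h2
    have hkm := hT.anc_mem (hT.mem j hj h0) hk
    have h3 := (hT.treeLE_iff hkm).1 h1
    rcases h3.eq_or_parent with h | ⟨hk0, h⟩
    · exact hne h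
    · have := hT.anc_depth (hT.mem k hkm hk0) h
      have := hT.depth k hkm hk0
      have := hT.anc_depth (hT.mem j hj h0) hk
      omega

theorem par_eq (hT : IsParentMap T f d) {j : Fin (n + 1)} (hj : j ∈ T.verts) (h0 : j ≠ 0) :
    T.par j = f j := by
  have hex : ∃ i, T.IsParent i j := ⟨f j, (hT.isParent_iff hj h0).2 rfl⟩
  rw [par, dif_pos hex]
  exact (hT.isParent_iff hj h0).1 hex.choose_spec

theorem parent_injOn (hT : IsParentMap T f d) {v w : Fin (n + 1)} (hv : v ∈ T.verts) (hv0 : v ≠ 0)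
    (hw : w ∈ T.verts) (hw0 : w ≠ 0) (h : s(v, f v) = s(w, f w)) : v = w := by
  rcases Sym2.eq_iff.1 h with ⟨h, -⟩ | ⟨h1, h2⟩
  · exact h
  · have h3 := hT.depth v hv hv0
    have h4 := hT.depth w hw hw0
    rw [h2] at h3
    rw [← h1] at h4
    omega

theorem edges_eq_image (hT : IsParentMap T f d) :
    T.edges = (T.verts.erase 0).image fun v => s(v, f v) := by
  ext e
  rw [edges, Finset.mem_filter, hT.weight_ne_zero, Finset.mem_image]
  constructor
  · rintro ⟨-, v, hv, h0, rfl⟩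
    exact ⟨v, Finset.mem_erase.2 ⟨h0, hv⟩, rfl⟩
  · rintro ⟨v, hv, rfl⟩
    exact ⟨Finset.mem_univ _, v, (Finset.mem_erase.1 hv).2, (Finset.mem_erase.1 hv).1, rfl⟩

theorem card_edges (hT : IsParentMap T f d) : T.edges.card + 1 = T.verts.card := by
  rw [hT.edges_eq_image, Finset.card_image_of_injOn, Finset.card_erase_add_one T.root_mem]
  intro v hv w hw h
  rw [Finset.mem_coe, Finset.mem_erase] at hv hw
  exact hT.parent_injOn hv.2 hv.1 hw.2 hw.1 h

theorem weight_of_mem_edges (hT : IsParentMap T f d) {e : Sym2 (Fin (n + 1))} (he : e ∈ T.edges) :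
    T.weight e = 1 := by
  rw [edges, Finset.mem_filter, hT.weight_ne_zero] at he
  rw [hT.weight, if_pos he.2]

theorem numEdges_eq (hT : IsParentMap T f d) : T.numEdges = T.edges.card := by
  rw [numEdges, Finset.card_eq_sum_ones, edges, Finset.sum_filter]
  refine Finset.sum_congr rfl fun e _ => ?_
  by_cases h : T.weight e = 0
  · simp [h]
  · rw [if_pos h]
    exact hT.weight_of_mem_edges (Finset.mem_filter.2 ⟨Finset.mem_univ _, h⟩)

theorem connected (hT : IsParentMap T f d) : T.Connected := by
  intro U hU hUT h0
  -- The parent of a vertex of least depth in `U` lies outside `U`.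
  obtain ⟨i, hi, hmin⟩ := Finset.exists_min_image U d hU
  have hi0 : i ≠ 0 := fun h => h0 (h ▸ hi)
  refine ⟨i, hi, ?_⟩
  have hf : f i ∈ T.verts \ U := by
    refine Finset.mem_sdiff.2 ⟨hT.mem i (hUT hi) hi0, fun h => ?_⟩
    have := hmin _ h
    have := hT.depth i (hUT hi) hi0
    omega
  refine (hT.weight_parent (hUT hi) hi0).symm.le.trans ?_
  exact Finset.single_le_sum (f := fun j => T.weight s(i, j)) (fun _ _ => Nat.zero_le _) hf

theorem isTree (hT : IsParentMap T f d) : T.IsTree :=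
  ⟨hT.connected, by rw [hT.numEdges_eq, hT.card_edges]⟩

theorem single (n : ℕ) : IsParentMap (single n) id (fun _ => 0) where
  mem v hv h0 := absurd (Finset.mem_singleton.1 hv) h0
  depth v hv h0 := absurd (Finset.mem_singleton.1 hv) h0
  weight e := by
    rw [if_neg]
    · rfl
    · rintro ⟨v, hv, h0, -⟩
      exact h0 (Finset.mem_singleton.1 hv)

theorem verts_addEdge {h j : Fin (n + 1)} (hh : h ∈ T.verts) :
    (T.addEdge h j).verts = insert j T.verts := by
  change insert h (insert j T.verts) = _
  rw [Finset.insert_eq_of_mem (Finset.mem_insert_of_mem hh)]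

/-- Attaching a leaf. -/
theorem addEdge (hT : IsParentMap T f d) {h j : Fin (n + 1)} (hh : h ∈ T.verts)
    (hj : j ∉ T.verts) :
    IsParentMap (T.addEdge h j) (Function.update f j h) (Function.update d j (d h + 1)) := by
  have hne : ∀ v ∈ T.verts, v ≠ j := fun v hv hvj => hj (hvj ▸ hv)
  have hold : ∀ v ∈ T.verts, Function.update f j h v = f v := fun v hv =>
    Function.update_of_ne (hne v hv) _ _
  constructor
  · intro v hv h0
    rw [verts_addEdge hh] at hv ⊢
    rcases Finset.mem_insert.1 hv with rfl | hv
    · rw [Function.update_self]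
      exact Finset.mem_insert_of_mem hh
    · rw [hold v hv]
      exact Finset.mem_insert_of_mem (hT.mem v hv h0)
  · intro v hv h0
    rw [verts_addEdge hh] at hv
    rcases Finset.mem_insert.1 hv with rfl | hv
    · rw [Function.update_self, Function.update_self, Function.update_of_ne (hne h hh)]
      omega
    · rw [hold v hv, Function.update_of_ne (hne v hv), Function.update_of_ne (hne _ (hT.mem v hv h0))]
      exact hT.depth v hv h0
  · intro e
    have hj0 : j ≠ 0 := fun h => hj (h ▸ T.root_mem)
    change T.weight e + (if e = s(h, j) ∧ h ≠ j then 1 else 0) = _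
    by_cases he : e = s(h, j)
    · subst he
      have h1 : T.weight s(h, j) = 0 := by
        by_contra hw
        exact hj (T.incident j h (by rwa [Sym2.eq_swap]))
      rw [h1, if_pos ⟨rfl, hne h hh⟩, if_pos]
      refine ⟨j, ?_, hj0, ?_⟩
      · rw [verts_addEdge hh]
        exact Finset.mem_insert_self _ _
      · rw [Function.update_self, Sym2.eq_swap]
    · rw [if_neg (fun h => he h.1), add_zero, hT.weight]
      congr 1
      apply propext
      rw [verts_addEdge hh]
      constructor
      · rintro ⟨v, hv, h0, rfl⟩
        exact ⟨v, Finset.mem_insert_of_mem hv, h0, by rw [hold v hv]⟩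
      · rintro ⟨v, hv, h0, rfl⟩
        rcases Finset.mem_insert.1 hv with rfl | hv
        · rw [Function.update_self, Sym2.eq_swap] at he
          exact absurd rfl he
        · exact ⟨v, hv, h0, by rw [hold v hv]⟩

theorem anc_update_of_mem (hT : IsParentMap T f d) {h j : Fin (n + 1)} (hj : j ∉ T.verts)
    {i k : Fin (n + 1)} (hk : k ∈ T.verts) : Anc (Function.update f j h) i k ↔ Anc f i k := by
  have hold : ∀ v ∈ T.verts, Function.update f j h v = f v := fun v hv =>
    Function.update_of_ne (ne_of_mem_of_not_mem hv hj) _ _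
  induction hd : d k using Nat.strong_induction_on generalizing k with
  | _ m ih =>
    by_cases hk0 : k = 0
    · subst hk0
      exact ⟨fun h => h.eq_zero ▸ Anc.refl _ _, fun h => h.eq_zero ▸ Anc.refl _ _⟩
    · have ih' := ih _ (hd ▸ hT.depth k hk hk0) (hT.mem k hk hk0) rfl
      constructor
      · intro h
        rcases h.eq_or_parent with h | h
        · exact h ▸ Anc.refl _ _
        · rw [hold k hk] at h
          exact (ih'.1 h.2).of_parent hk0
      · intro h
        rcases h.eq_or_parent with h | h
        · exact h ▸ Anc.refl _ _
        · refine Anc.of_parent hk0 ?_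
          rw [hold k hk]
          exact ih'.2 h.2

theorem anc_update_self (hT : IsParentMap T f d) {h j : Fin (n + 1)} (hh : h ∈ T.verts)
    (hj : j ∉ T.verts) {i : Fin (n + 1)} :
    Anc (Function.update f j h) i j ↔ i = j ∨ Anc f i h := by
  have hj0 : j ≠ 0 := fun h => hj (h ▸ T.root_mem)
  constructor
  · intro hi
    rcases hi.eq_or_parent with hi | hi
    · exact Or.inl hi
    · rw [Function.update_self, hT.anc_update_of_mem hj hh] at hi
      exact Or.inr hi.2
  · rintro (rfl | hi)
    · exact Anc.refl _ _
    · refine Anc.of_parent hj0 ?_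
      rwa [Function.update_self, hT.anc_update_of_mem hj hh]

/-- The parent functions of a tree and of a subtree agree on the subtree. -/
theorem parent_eq_of_le {T' : Multigraph n} {f' : Fin (n + 1) → Fin (n + 1)}
    {d' : Fin (n + 1) → ℕ} (hT : IsParentMap T f d) (hT' : IsParentMap T' f' d')
    (hle : ∀ e, T.weight e ≠ 0 → T'.weight e ≠ 0) {v : Fin (n + 1)} (hv : v ∈ T.verts)
    (h0 : v ≠ 0) : f v = f' v := by
  induction hd : d v using Nat.strong_induction_on generalizing v with
  | _ m ih =>
    have hw : T'.weight s(v, f v) ≠ 0 := hle _ (by rw [hT.weight_parent hv h0]; exact one_ne_zero)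
    rcases hT'.adj hw with ⟨_, _, h⟩ | ⟨_, hfv, h⟩
    · exact h
    · have hdv := hT.depth v hv h0
      have h1 := ih _ (hd ▸ hdv) (hT.mem v hv h0) hfv rfl
      have h2 := hT.depth (f v) (hT.mem v hv h0) hfv
      rw [h1, ← h] at h2
      omega

end IsParentMap

/-! ### Every spanning tree has a parent function -/

theorem Connected.reachable {T : Multigraph n} (hT : T.Connected) (hV : T.verts = Finset.univ)
    (v : Fin (n + 1)) : T.toSimpleGraph.Reachable v 0 := by
  classical
  by_contra hv
  obtain ⟨i, hi, hdeg⟩ := hT (Finset.univ.filter fun v => ¬ T.toSimpleGraph.Reachable v 0)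
    ⟨v, Finset.mem_filter.2 ⟨Finset.mem_univ _, hv⟩⟩ (by rw [hV]; exact Finset.subset_univ _)
    (fun h => (Finset.mem_filter.1 h).2 (SimpleGraph.Reachable.refl _))
  obtain ⟨j, hj, hij⟩ := Finset.exists_ne_zero_of_sum_ne_zero (Nat.one_le_iff_ne_zero.1 hdeg)
  have hadj : T.toSimpleGraph.Adj i j := hij
  have hj' : T.toSimpleGraph.Reachable j 0 := by
    by_contra h
    exact (Finset.mem_sdiff.1 hj).2 (Finset.mem_filter.2 ⟨Finset.mem_univ _, h⟩)
  exact (Finset.mem_filter.1 hi).2 (hadj.reachable.trans hj')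

/-- The parent is the next vertex on a shortest walk to the root. This gives `n` distinct edges of
positive weight; as the total weight is `n`, there are no others and all weights are one. -/
theorem IsTree.exists_isParentMap {T : Multigraph n} (hT : T.IsTree)
    (hV : T.verts = Finset.univ) : ∃ f d, IsParentMap T f d := by
  classical
  have hex : ∀ v : Fin (n + 1), ∃ w, v ≠ 0 →
      T.weight s(v, w) ≠ 0 ∧ T.toSimpleGraph.dist w 0 < T.toSimpleGraph.dist v 0 := by
    intro v
    by_cases h0 : v = 0
    · exact ⟨0, fun h => absurd h0 h⟩
    · obtain ⟨p, hp⟩ := (hT.1.reachable hV v).exists_walk_length_eq_dist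
      cases p with
      | nil => exact absurd rfl h0
      | @cons _ w _ hvw p =>
        refine ⟨w, fun _ => ⟨hvw, ?_⟩⟩
        have := SimpleGraph.dist_le p
        rw [SimpleGraph.Walk.length_cons] at hp
        omega
  choose f hf using hex
  set d : Fin (n + 1) → ℕ := fun v => T.toSimpleGraph.dist v 0
  set S : Finset (Sym2 (Fin (n + 1))) := (Finset.univ.erase 0).image fun v => s(v, f v) with hS
  have hcard : S.card = n := by
    rw [hS, Finset.card_image_of_injOn, Finset.card_erase_of_mem (Finset.mem_univ _),
      Finset.card_univ, Fintype.card_fin, Nat.add_sub_cancel]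
    intro v hv w hw h
    rw [Finset.mem_coe, Finset.mem_erase] at hv hw
    rcases Sym2.eq_iff.1 h with ⟨h, -⟩ | ⟨h1, h2⟩
    · exact h
    · have h3 := (hf v hv.1).2
      have h4 := (hf w hw.1).2
      rw [h2] at h3
      rw [← h1] at h4
      omega
  have hsum : ∑ e, T.weight e = ∑ e, if e ∈ S then 1 else 0 := by
    have h1 := hT.2
    rw [hV, Finset.card_univ, Fintype.card_fin] at h1
    rw [Finset.sum_ite_mem, Finset.univ_inter, ← Finset.card_eq_sum_ones, hcard]
    exact Nat.succ_injective h1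
  have hle : ∀ e ∈ Finset.univ, (if e ∈ S then 1 else 0) ≤ T.weight e := by
    intro e _
    split_ifs with he
    · obtain ⟨v, hv, rfl⟩ := Finset.mem_image.1 he
      exact Nat.one_le_iff_ne_zero.2 (hf v (Finset.mem_erase.1 hv).1).1
    · exact Nat.zero_le _
  have heq := (Finset.sum_eq_sum_iff_of_le hle).1 hsum.symm
  refine ⟨f, d, ⟨fun v _ _ => hV ▸ Finset.mem_univ _, fun v _ h0 => (hf v h0).2, fun e => ?_⟩⟩
  rw [← heq e (Finset.mem_univ _)]
  congr 1
  apply propext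
  rw [hS, Finset.mem_image, hV]
  constructor
  · rintro ⟨v, hv, rfl⟩
    exact ⟨v, Finset.mem_univ _, (Finset.mem_erase.1 hv).1, rfl⟩
  · rintro ⟨v, -, h0, rfl⟩
    exact ⟨v, Finset.mem_erase.2 ⟨h0, Finset.mem_univ _⟩, rfl⟩

end Multigraph

theorem NonRoot.val_injective {n : ℕ} : Function.Injective (NonRoot.val (n := n)) :=
  fun _ _ h => Subtype.ext h

theorem NonRoot.val_ne_zero {n : ℕ} (i : NonRoot n) : i.val ≠ 0 := i.2

theorem NonRoot.exists_val {n : ℕ} {v : Fin (n + 1)} (hv : v ≠ 0) : ∃ i : NonRoot n, i.val = v :=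
  ⟨⟨v, hv⟩, rfl⟩

theorem sum_update_add_one {ι : Type*} [Fintype ι] [DecidableEq ι] (g : ι → ℕ) (i : ι) :
    ∑ k, Function.update g i (g i + 1) k = ∑ k, g k + 1 := by
  rw [Finset.sum_update_of_mem (Finset.mem_univ _), add_right_comm,
    ← Finset.sum_eq_add_sum_sdiff_singleton_of_mem (Finset.mem_univ i)]

namespace Multigraph

variable {n : ℕ}

/-! ### The common machine and its determinism -/

namespace BurnState

/-- Burn a copy of the edge between the head and `j`. Here `chips` counts the burnt edges. -/
def burnEdge [DecidableEq (NonRoot n)] (s : BurnState n) (j : NonRoot n) : BurnState n :=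
  { s with
    burnt := Function.update s.burnt s(s.head, j.val) (s.burnt s(s.head, j.val) + 1)
    chips := Function.update s.chips j (s.chips j + 1) }

/-- The vertex `j` starts to burn. -/
def ignite (G : Multigraph n) (s : BurnState n) (j : NonRoot n) : BurnState n where
  burning := insert j.val s.burning
  burnt := s.burnt
  T := s.T.addEdge s.head j.val
  label := Function.update s.label s(s.head, j.val)
    (G.weight s(s.head, j.val) - (s.burnt s(s.head, j.val) + 1))
  head := j.val
  chips := s.chips

/-- Return to the parent of the head. -/
noncomputable def back (s : BurnState n) : BurnState n :=
  { s with head := s.T.par s.head }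

end BurnState

/-- An unburnt copy of the edge between the head and `j` is the next to be considered. -/
def IsNext (G : Multigraph n) [LinearOrder (NonRoot n)] (s : BurnState n) (j : NonRoot n) : Prop :=
  j.val ∉ s.burning ∧ s.burnt s(s.head, j.val) < G.weight s(s.head, j.val) ∧
    ∀ k : NonRoot n, j < k → k.val ∉ s.burning →
      s.burnt s(s.head, k.val) = G.weight s(s.head, k.val)

/-- All edges between the head and vertices that do not burn are burnt. -/
def Exhausted (G : Multigraph n) (s : BurnState n) : Prop :=
  ∀ k : NonRoot n, k.val ∉ s.burning → s.burnt s(s.head, k.val) = G.weight s(s.head, k.val)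

/-- The elementary steps of depth-first burning, where `D` decides whether the next edge makes its
end burn. -/
inductive Step (G : Multigraph n) [LinearOrder (NonRoot n)] (D : BurnState n → NonRoot n → Prop) :
    BurnState n → BurnState n → Prop
  | burnEdge (s : BurnState n) (j : NonRoot n) (hj : G.IsNext s j) (hD : ¬ D s j) :
    Step G D s (s.burnEdge j)
  | ignite (s : BurnState n) (j : NonRoot n) (hj : G.IsNext s j) (hD : D s j) :
    Step G D s (s.ignite G j)
  | back (s : BurnState n) (h0 : s.head ≠ 0) (h : G.Exhausted s) : Step G D s s.back

/-- The state from which depth-first burning stops. -/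
def Terminal (G : Multigraph n) (s : BurnState n) : Prop :=
  s.head = 0 ∧ G.Exhausted s

section Deterministic

variable {G : Multigraph n} [LinearOrder (NonRoot n)] {D : BurnState n → NonRoot n → Prop}

theorem IsNext.unique {s : BurnState n} {j k : NonRoot n} (hj : G.IsNext s j)
    (hk : G.IsNext s k) : j = k := by
  rcases lt_trichotomy j k with h | h | h
  · exact absurd (hj.2.2 k h hk.1) hk.2.1.ne
  · exact h
  · exact absurd (hk.2.2 j h hj.1) hj.2.1.ne

theorem IsNext.not_exhausted {s : BurnState n} {j : NonRoot n} (hj : G.IsNext s j) :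
    ¬ G.Exhausted s :=
  fun h => hj.2.1.ne (h j hj.1)

theorem Step.unique {s t u : BurnState n} (ht : G.Step D s t) (hu : G.Step D s u) : t = u := by
  cases ht with
  | burnEdge j hj hD =>
    cases hu with
    | burnEdge k hk hD' => rw [hj.unique hk]
    | ignite k hk hD' => exact absurd (hj.unique hk ▸ hD') hD
    | back h0 h => exact absurd h hj.not_exhausted
  | ignite j hj hD =>
    cases hu with
    | burnEdge k hk hD' => exact absurd (hj.unique hk ▸ hD) hD'
    | ignite k hk hD' => rw [hj.unique hk]
    | back h0 h => exact absurd h hj.not_exhausted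
  | back h0 h =>
    cases hu with
    | burnEdge k hk hD' => exact absurd h hk.not_exhausted
    | ignite k hk hD' => exact absurd h hk.not_exhausted
    | back h0 h => rfl

theorem Terminal.not_step {s t : BurnState n} (hs : G.Terminal s) : ¬ G.Step D s t := by
  intro h
  cases h with
  | burnEdge j hj hD => exact hj.not_exhausted hs.2
  | ignite j hj hD => exact hj.not_exhausted hs.2
  | back h0 h => exact h0 hs.1

theorem Terminal.unique {s t u : BurnState n} (ht : G.Terminal t) (hu : G.Terminal u)
    (hst : Relation.ReflTransGen (G.Step D) s t) (hsu : Relation.ReflTransGen (G.Step D) s u) :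
    t = u := by
  have hu' : Relator.RightUnique (G.Step D) := fun _ _ _ h h' => Step.unique h h'
  rcases Relation.ReflTransGen.total_of_right_unique hu' hst hsu with h | h
  · rcases Relation.ReflTransGen.cases_head h with h | ⟨_, h, -⟩
    · exact h
    · exact absurd h ht.not_step
  · rcases Relation.ReflTransGen.cases_head h with h | ⟨_, h, -⟩
    · exact h.symm
    · exact absurd h hu.not_step

end Deterministic

/-! ### Invariants and termination -/

/-- The invariants of depth-first burning. -/
structure Inv (G : Multigraph n) [LinearOrder (NonRoot n)] (s : BurnState n)
    (f : Fin (n + 1) → Fin (n + 1)) (d : Fin (n + 1) → ℕ) : Prop where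
  tree : IsParentMap s.T f d
  verts : s.T.verts = s.burning
  head_mem : s.head ∈ s.burning
  burnt_le : ∀ e, s.burnt e ≤ G.weight e
  burnt_out : ∀ a b, a ∉ s.burning → b ∉ s.burning → s.burnt s(a, b) = 0
  tree_burnt : ∀ v ∈ s.burning, v ≠ 0 → s.burnt s(v, f v) < G.weight s(v, f v) ∧
    s.label s(v, f v) = G.weight s(v, f v) - (s.burnt s(v, f v) + 1)
  label_out : ∀ e, s.T.weight e = 0 → s.label e = 0
  done : ∀ v ∈ s.burning, ¬ Anc f v s.head → ∀ j ∉ s.burning, s.burnt s(v, j) = G.weight s(v, j)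
  -- The scan at the parent of `i` is suspended at `i`: larger vertices are finished and smaller
  -- ones are not yet reached.
  stack : ∀ i j : NonRoot n, Anc f i.val s.head → j.val ∉ s.burning →
    (i < j → s.burnt s(f i.val, j.val) = G.weight s(f i.val, j.val)) ∧
    (j < i → s.burnt s(f i.val, j.val) = 0)
  -- The same for the scan in progress at the head; it becomes the `stack` condition when a vertex
  -- ignites.
  stair : ∀ j k : NonRoot n, j.val ∉ s.burning → k.val ∉ s.burning → k < j →
    s.burnt s(s.head, j.val) < G.weight s(s.head, j.val) → s.burnt s(s.head, k.val) = 0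
  -- This and the next condition preserve what `stack` and `done` say about a vertex at the moment
  -- it ignites.
  comparable : ∀ i j : NonRoot n, j.val ∈ s.burning → Anc f i.val j.val →
    (i < j → s.burnt s(f i.val, j.val) = G.weight s(f i.val, j.val)) ∧
    (j < i → s.burnt s(f i.val, j.val) = 0)
  incomparable : ∀ v ∈ s.burning, ∀ w ∈ s.burning, ¬ Anc f v w → ¬ Anc f w v →
    s.burnt s(v, w) = G.weight s(v, w)
  chips_out : ∀ j : NonRoot n, j.val ∉ s.burning → s.chips j = ∑ v, s.burnt s(v, j.val)
  chips_sum : ∑ j, s.chips j = ∑ e, s.burnt e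
  parking : ∀ U : Finset (Fin (n + 1)), 0 ∉ U → (∃ i ∈ U, i ∈ s.burning) →
    ∃ i : NonRoot n, i.val ∈ U ∧ i.val ∈ s.burning ∧ s.chips i + 1 ≤ G.deg U i.val

/-- A quantity that decreases in each step, if `d` is the depth in the tree. -/
def potential (G : Multigraph n) (s : BurnState n) (d : Fin (n + 1) → ℕ) : ℕ :=
  d s.head + 2 * (s.burningᶜ).card + ∑ e, (G.weight e - s.burnt e)

section Inv

variable {G : Multigraph n} [LinearOrder (NonRoot n)] {D : BurnState n → NonRoot n → Prop}

/-- The counter `chips` starts at zero for both algorithms, since it records burnt edges and not the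
chips left over. -/
theorem inv_init (G : Multigraph n) :
    G.Inv (burnInit fun _ => 0) id (fun _ => 0) where
  tree := IsParentMap.single n
  verts := rfl
  head_mem := Finset.mem_singleton_self _
  burnt_le _ := Nat.zero_le _
  burnt_out _ _ _ _ := rfl
  tree_burnt v hv h0 := absurd (Finset.mem_singleton.1 hv) h0
  label_out _ _ := rfl
  done v hv h := by
    rw [Finset.mem_singleton.1 hv] at h
    exact absurd (Anc.refl _ _) h
  stack i j h := absurd h.eq_zero i.val_ne_zero
  stair _ _ _ _ _ _ := rfl
  comparable i j hj := absurd (Finset.mem_singleton.1 hj) j.val_ne_zero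
  incomparable v hv w hw h := by
    rw [Finset.mem_singleton.1 hv, Finset.mem_singleton.1 hw] at h
    exact absurd (Anc.refl _ _) h
  chips_out _ _ := by simp [burnInit]
  chips_sum := by simp [burnInit]
  parking U hU := by
    rintro ⟨i, hi, hi'⟩
    exact absurd (Finset.mem_singleton.1 hi' ▸ hi) hU

variable {s : BurnState n} {f : Fin (n + 1) → Fin (n + 1)} {d : Fin (n + 1) → ℕ}

namespace Inv

theorem zero_mem (hs : G.Inv s f d) : 0 ∈ s.burning := hs.verts ▸ s.T.root_mem

theorem par_head (hs : G.Inv s f d) (h0 : s.head ≠ 0) : s.T.par s.head = f s.head :=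
  hs.tree.par_eq (hs.verts ▸ hs.head_mem) h0

theorem anc_mem (hs : G.Inv s f d) {i j : Fin (n + 1)} (hj : j ∈ s.burning) (h : Anc f i j) :
    i ∈ s.burning := by
  rw [← hs.verts] at hj ⊢
  exact hs.tree.anc_mem hj h

theorem parent_mem (hs : G.Inv s f d) {i : Fin (n + 1)} (hi : i ∈ s.burning) (h0 : i ≠ 0) :
    f i ∈ s.burning := by
  rw [← hs.verts] at hi ⊢
  exact hs.tree.mem i hi h0

theorem parent_ne_head (hs : G.Inv s f d) {i : Fin (n + 1)} (hi : Anc f i s.head) (h0 : i ≠ 0) :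
    f i ≠ s.head := by
  intro h
  have h1 := hs.tree.anc_depth (hs.verts ▸ hs.head_mem) hi
  have h2 := hs.tree.depth i (hs.tree.anc_mem (hs.verts ▸ hs.head_mem) hi) h0
  rw [h] at h2
  omega

theorem burnEdge {j : NonRoot n} (hs : G.Inv s f d) (hj : G.IsNext s j) :
    G.Inv (s.burnEdge j) f d := by
  obtain ⟨hjB, hlt, hfull⟩ := hj
  have hhB := hs.head_mem
  have hb : ∀ a b, a ∈ s.burning → (a ≠ s.head ∨ b ≠ j.val) →
      (s.burnEdge j).burnt s(a, b) = s.burnt s(a, b) := by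
    intro a b ha hab
    refine Function.update_of_ne (fun h => ?_) _ _
    rcases Sym2.eq_iff.1 h with ⟨h1, h2⟩ | ⟨h1, h2⟩
    · exact hab.elim (fun h => h h1) (fun h => h h2)
    · exact hjB (h1 ▸ ha)
  have hb1 : (s.burnEdge j).burnt s(s.head, j.val) = s.burnt s(s.head, j.val) + 1 :=
    Function.update_self _ _ _
  have hbin : ∀ a b, a ∈ s.burning → b ∈ s.burning →
      (s.burnEdge j).burnt s(a, b) = s.burnt s(a, b) := fun a b ha hb' =>
    hb a b ha (Or.inr (ne_of_mem_of_not_mem hb' hjB))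
  refine ⟨hs.tree, hs.verts, hs.head_mem, ?_, ?_, ?_, hs.label_out, ?_, ?_, ?_, ?_, ?_, ?_, ?_, ?_⟩
  · intro e
    by_cases he : e = s(s.head, j.val)
    · rw [he, hb1]
      exact hlt
    · have : (s.burnEdge j).burnt e = s.burnt e := Function.update_of_ne he _ _
      rw [this]
      exact hs.burnt_le e
  · intro a b ha hb'
    have : (s.burnEdge j).burnt s(a, b) = s.burnt s(a, b) := by
      refine Function.update_of_ne (fun h => ?_) _ _
      rcases Sym2.eq_iff.1 h with ⟨h1, h2⟩ | ⟨h1, h2⟩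
      · exact ha (h1 ▸ hhB)
      · exact hb' (h2 ▸ hhB)
    rw [this]
    exact hs.burnt_out a b ha hb'
  · intro v hv h0
    rw [hbin v (f v) hv (hs.parent_mem hv h0)]
    exact hs.tree_burnt v hv h0
  · intro v hv hvh k hk
    rw [hb v k hv (Or.inl fun h => hvh (by rw [h]; exact Anc.refl _ _))]
    exact hs.done v hv hvh k hk
  · intro i k hi hk
    rw [hb (f i.val) k.val (hs.parent_mem (hs.anc_mem hhB hi) i.val_ne_zero)
      (Or.inl (hs.parent_ne_head hi i.val_ne_zero))]
    exact hs.stack i k hi hk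
  · intro k l hk hl hlk hlt'
    change (s.burnEdge j).burnt s(s.head, k.val) < _ at hlt'
    change (s.burnEdge j).burnt s(s.head, l.val) = 0
    by_cases hkj : k = j
    · subst hkj
      rw [hb s.head l.val hhB (Or.inr fun h => hlk.ne (NonRoot.val_injective h))]
      exact hs.stair k l hk hl hlk hlt
    · rw [hb s.head k.val hhB (Or.inr fun h => hkj (NonRoot.val_injective h))] at hlt'
      -- The vertex `j` being burnt into is the largest one outside `burning` with an unburnt copy,
      -- so no unfinished `k` lies above it.
      by_cases hlj : l = j
      · subst hlj
        exact absurd (hfull k hlk hk) hlt'.ne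
      · rw [hb s.head l.val hhB (Or.inr fun h => hlj (NonRoot.val_injective h))]
        exact hs.stair k l hk hl hlk hlt'
  · intro i k hk hik
    rw [hbin (f i.val) k.val (hs.parent_mem (hs.anc_mem hk hik) i.val_ne_zero) hk]
    exact hs.comparable i k hk hik
  · intro v hv w hw h1 h2
    rw [hbin v w hv hw]
    exact hs.incomparable v hv w hw h1 h2
  · intro k hk
    by_cases hkj : k = j
    · subst hkj
      have h1 : (s.burnEdge k).chips k = s.chips k + 1 := Function.update_self _ _ _
      rw [h1, hs.chips_out k hk, ← Finset.add_sum_erase _ _ (Finset.mem_univ s.head),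
        ← Finset.add_sum_erase _ _ (Finset.mem_univ s.head), hb1, add_right_comm]
      congr 1
      refine Finset.sum_congr rfl fun v hv => ?_
      symm
      refine Function.update_of_ne (fun h => ?_) _ _
      rcases Sym2.eq_iff.1 h with ⟨h1, h2⟩ | ⟨h1, h2⟩
      · exact Finset.ne_of_mem_erase hv h1
      · exact hjB (h2 ▸ hhB)
    · have h1 : (s.burnEdge j).chips k = s.chips k := Function.update_of_ne hkj _ _
      rw [h1, hs.chips_out k hk]
      refine Finset.sum_congr rfl fun v hv => ?_
      symm
      refine Function.update_of_ne (fun h => ?_) _ _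
      rcases Sym2.eq_iff.1 h with ⟨h1, h2⟩ | ⟨h1, h2⟩
      · exact hkj (NonRoot.val_injective h2)
      · exact hk (h2 ▸ hhB)
  · change ∑ k, Function.update s.chips j (s.chips j + 1) k =
      ∑ e, Function.update s.burnt s(s.head, j.val) (s.burnt s(s.head, j.val) + 1) e
    rw [sum_update_add_one, sum_update_add_one, hs.chips_sum]
  · intro U hU hex
    obtain ⟨i, hiU, hi, hle⟩ := hs.parking U hU hex
    refine ⟨i, hiU, hi, ?_⟩
    have h1 : (s.burnEdge j).chips i = s.chips i :=
      Function.update_of_ne (fun h => hjB (by rwa [← h])) _ _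
    rwa [h1]

theorem ignite (hV : G.verts = Finset.univ) {j : NonRoot n} (hs : G.Inv s f d)
    (hj : G.IsNext s j) : G.Inv (s.ignite G j) (Function.update f j.val s.head)
      (Function.update d j.val (d s.head + 1)) := by
  obtain ⟨hjB, hlt, hfull⟩ := hj
  have hhB := hs.head_mem
  have hhV : s.head ∈ s.T.verts := hs.verts ▸ hhB
  have hjV : j.val ∉ s.T.verts := hs.verts ▸ hjB
  have hne : ∀ v ∈ s.burning, v ≠ j.val := fun v hv => ne_of_mem_of_not_mem hv hjB
  have hf : ∀ v ∈ s.burning, Function.update f j.val s.head v = f v := fun v hv =>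
    Function.update_of_ne (hne v hv) _ _
  have hanc : ∀ i k, k ∈ s.burning → (Anc (Function.update f j.val s.head) i k ↔ Anc f i k) :=
    fun i k hk => hs.tree.anc_update_of_mem hjV (hs.verts ▸ hk)
  have hancj : ∀ i, Anc (Function.update f j.val s.head) i j.val ↔ i = j.val ∨ Anc f i s.head :=
    fun i => hs.tree.anc_update_self hhV hjV
  have hout : ∀ v, v ∉ (s.ignite G j).burning → v ≠ j.val ∧ v ∉ s.burning := fun v hv =>
    ⟨fun h => hv (h ▸ Finset.mem_insert_self _ _), fun h => hv (Finset.mem_insert_of_mem h)⟩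
  refine ⟨hs.tree.addEdge hhV hjV, ?_, Finset.mem_insert_self _ _, hs.burnt_le, ?_, ?_, ?_, ?_, ?_,
    ?_, ?_, ?_, ?_, hs.chips_sum, ?_⟩
  · exact (IsParentMap.verts_addEdge hhV).trans (by rw [hs.verts]; rfl)
  · exact fun a b ha hb => hs.burnt_out a b (hout a ha).2 (hout b hb).2
  · intro v hv h0
    rcases Finset.mem_insert.1 hv with rfl | hv
    · rw [Function.update_self, Sym2.eq_swap]
      exact ⟨hlt, Function.update_self _ _ _⟩
    · rw [hf v hv]
      have hlab : (s.ignite G j).label s(v, f v) = s.label s(v, f v) := by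
        refine Function.update_of_ne (fun h => ?_) _ _
        rcases Sym2.eq_iff.1 h with ⟨h1, h2⟩ | ⟨h1, h2⟩
        · exact hne _ (hs.parent_mem hv h0) h2
        · exact hne _ hv h1
      rw [hlab]
      exact hs.tree_burnt v hv h0
  · intro e he
    have he' : s.T.weight e + (if e = s(s.head, j.val) ∧ s.head ≠ j.val then 1 else 0) = 0 := he
    have hne' : e ≠ s(s.head, j.val) := by
      intro h
      rw [if_pos ⟨h, hne _ hhB⟩] at he'
      omega
    have hlab : (s.ignite G j).label e = s.label e := Function.update_of_ne hne' _ _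
    rw [hlab]
    exact hs.label_out e (by omega)
  · intro v hv hvj k hk
    rcases Finset.mem_insert.1 hv with rfl | hv
    · exact absurd (Anc.refl _ _) hvj
    · exact hs.done v hv (fun h => hvj ((hancj v).2 (Or.inr h))) k (hout k hk).2
  · intro i k hi hk
    replace hk := (hout _ hk).2
    rcases (hancj _).1 hi with hi | hi
    · obtain rfl := NonRoot.val_injective hi
      rw [Function.update_self]
      exact ⟨fun h => hfull k h hk, fun h => hs.stair i k hjB hk h hlt⟩
    · rw [hf _ (hs.anc_mem hhB hi)]
      exact hs.stack i k hi hk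
  · intro k l hk hl _ _
    exact hs.burnt_out _ _ hjB (hout _ hl).2
  · intro i k hk hik
    rcases Finset.mem_insert.1 hk with hk | hk
    · obtain rfl := NonRoot.val_injective hk
      rcases (hancj _).1 hik with hi | hi
      · obtain rfl := NonRoot.val_injective hi
        exact ⟨fun h => absurd h (lt_irrefl _), fun h => absurd h (lt_irrefl _)⟩
      · rw [hf _ (hs.anc_mem hhB hi)]
        exact hs.stack i k hi hjB
    · rw [hanc _ _ hk] at hik
      rw [hf _ (hs.anc_mem hk hik)]
      exact hs.comparable i k hk hik
  · intro v hv w hw h1 h2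
    rcases Finset.mem_insert.1 hv with rfl | hv <;> rcases Finset.mem_insert.1 hw with rfl | hw
    · exact absurd (Anc.refl _ _) h1
    · rw [Sym2.eq_swap]
      exact hs.done w hw (fun h => h2 ((hancj w).2 (Or.inr h))) _ hjB
    · exact hs.done v hv (fun h => h1 ((hancj v).2 (Or.inr h))) _ hjB
    · rw [hanc _ _ hw] at h1
      rw [hanc _ _ hv] at h2
      exact hs.incomparable v hv w hw h1 h2
  · exact fun k hk => hs.chips_out k (hout _ hk).2
  · rintro U hU ⟨i, hiU, hi⟩
    by_cases hex : ∃ i ∈ U, i ∈ s.burning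
    · obtain ⟨i, hiU, hi, hle⟩ := hs.parking U hU hex
      exact ⟨i, hiU, Finset.mem_insert_of_mem hi, hle⟩
    -- Here `j` is the first vertex of `U` to burn. Every edge burnt into it comes from outside `U`,
    -- and the copy that ignites it stays unburnt, which makes the inequality strict.
    · have hUB : ∀ v ∈ U, v ∉ s.burning := fun v hv hvB => hex ⟨v, hv, hvB⟩
      obtain rfl := (Finset.mem_insert.1 hi).resolve_right (hUB i hiU)
      refine ⟨j, hiU, Finset.mem_insert_self _ _, ?_⟩
      change s.chips j + 1 ≤ _
      rw [hs.chips_out j hjB, deg, hV, Nat.add_one_le_iff]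
      calc ∑ v, s.burnt s(v, j.val) = ∑ v ∈ Finset.univ \ U, s.burnt s(v, j.val) := by
            symm
            refine Finset.sum_subset (Finset.subset_univ _) fun v _ hv => ?_
            have hvU : v ∈ U := by
              by_contra h
              exact hv (Finset.mem_sdiff.2 ⟨Finset.mem_univ _, h⟩)
            exact hs.burnt_out _ _ (hUB v hvU) hjB
        _ < ∑ v ∈ Finset.univ \ U, G.weight s(j.val, v) := by
            refine Finset.sum_lt_sum (fun v _ => ?_) ⟨s.head, ?_, ?_⟩
            · rw [Sym2.eq_swap]
              exact hs.burnt_le _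
            · exact Finset.mem_sdiff.2 ⟨Finset.mem_univ _, fun h => hUB _ h hhB⟩
            · rwa [Sym2.eq_swap (a := j.val)]

theorem back (hs : G.Inv s f d) (h0 : s.head ≠ 0) (hfull : G.Exhausted s) :
    G.Inv s.back f d := by
  have hpar : s.back.head = f s.head := hs.par_head h0
  have hhB := hs.head_mem
  have hanc : ∀ {i}, Anc f i (f s.head) → Anc f i s.head := fun h => h.of_parent h0
  obtain ⟨i, hi⟩ := NonRoot.exists_val h0
  have hi' : Anc f i.val s.head := hi ▸ Anc.refl _ _
  refine ⟨hs.tree, hs.verts, ?_, hs.burnt_le, hs.burnt_out, hs.tree_burnt, hs.label_out, ?_, ?_,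
    ?_, hs.comparable, hs.incomparable, hs.chips_out, hs.chips_sum, hs.parking⟩
  · rw [hpar]
    exact hs.parent_mem hhB h0
  · intro v hv hvh k hk
    rw [hpar] at hvh
    by_cases hvs : v = s.head
    · subst hvs
      obtain ⟨k, rfl⟩ := NonRoot.exists_val (fun h => hk (h ▸ hs.zero_mem) : k ≠ 0)
      exact hfull k hk
    · refine hs.done v hv (fun h => ?_) k hk
      rcases h.eq_or_parent with h | h
      · exact hvs h
      · exact hvh h.2
  · intro l k hl hk
    rw [hpar] at hl
    exact hs.stack l k (hanc hl) hk
  · intro k l hk hl hlk hlt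
    rw [hpar, ← hi] at hlt ⊢
    -- With `i` the vertex left behind, an unfinished edge at its parent can only lead to a vertex
    -- below `i`; below `i` that scan has burnt nothing.
    have hki : k < i := by
      rcases lt_trichotomy k i with h | h | h
      · exact h
      · exact absurd (show k.val ∈ s.burning from h ▸ hi ▸ hhB) hk
      · exact absurd ((hs.stack i k hi' hk).1 h) hlt.ne
    exact (hs.stack i l hi' hl).2 (hlk.trans hki)

theorem step (hV : G.verts = Finset.univ) {t : BurnState n} (hs : G.Inv s f d)
    (hst : G.Step D s t) : ∃ f' d', G.Inv t f' d' ∧ G.potential t d' < G.potential s d := by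
  cases hst with
  | burnEdge j hj hD =>
    refine ⟨f, d, hs.burnEdge hj, ?_⟩
    refine Nat.add_lt_add_left (Finset.sum_lt_sum (fun e _ => ?_)
      ⟨s(s.head, j.val), Finset.mem_univ _, ?_⟩) _
    · by_cases he : e = s(s.head, j.val)
      · have : (s.burnEdge j).burnt e = s.burnt e + 1 := by rw [he]; exact Function.update_self _ _ _
        omega
      · have : (s.burnEdge j).burnt e = s.burnt e := Function.update_of_ne he _ _
        rw [this]
    · have : (s.burnEdge j).burnt s(s.head, j.val) = s.burnt s(s.head, j.val) + 1 :=
        Function.update_self _ _ _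
      have := hj.2.1
      omega
  | ignite j hj hD =>
    refine ⟨_, _, hs.ignite hV hj, ?_⟩
    -- The head moves one level deeper, so each vertex outside `burning` must weigh two in the
    -- potential.
    refine Nat.add_lt_add_right ?_ _
    change Function.update d j.val (d s.head + 1) j.val + 2 * ((insert j.val s.burning)ᶜ).card < _
    rw [Function.update_self, Finset.compl_insert, Finset.card_erase_of_mem (Finset.mem_compl.2 hj.1)]
    have : 0 < (s.burningᶜ).card := Finset.card_pos.2 ⟨_, Finset.mem_compl.2 hj.1⟩
    omega
  | back h0 h =>
    refine ⟨f, d, hs.back h0 h, ?_⟩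
    refine Nat.add_lt_add_right (Nat.add_lt_add_right ?_ _) _
    change d (s.T.par s.head) < _
    rw [hs.par_head h0]
    exact hs.tree.depth _ (hs.verts ▸ hs.head_mem) h0

theorem steps (hV : G.verts = Finset.univ) {t : BurnState n} (hs : G.Inv s f d)
    (hst : Relation.ReflTransGen (G.Step D) s t) : ∃ f' d', G.Inv t f' d' := by
  induction hst with
  | refl => exact ⟨f, d, hs⟩
  | tail _ h ih =>
    obtain ⟨f', d', hs'⟩ := ih
    obtain ⟨f'', d'', h', -⟩ := hs'.step hV h
    exact ⟨f'', d'', h'⟩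

theorem transGen_step (hV : G.verts = Finset.univ) {t : BurnState n} (hs : G.Inv s f d)
    (hst : Relation.TransGen (G.Step D) s t) :
    ∃ f' d', G.Inv t f' d' ∧ G.potential t d' < G.potential s d := by
  induction hst with
  | single h => exact hs.step hV h
  | tail _ h ih =>
    obtain ⟨f', d', hs', hlt⟩ := ih
    obtain ⟨f'', d'', h', hlt'⟩ := hs'.step hV h
    exact ⟨f'', d'', h', hlt'.trans hlt⟩

end Inv

end Inv

/-! ### From nested loops to elementary steps -/

section Loops

variable (G : Multigraph n) [LinearOrder (NonRoot n)] (D : BurnState n → NonRoot n → Prop)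

open Classical in
/-- The inner loop of the burning algorithms, with an arbitrary decision `D`. -/
noncomputable def edgeLoop (j : NonRoot n) : ℕ → BurnState n → BurnState n × Bool
  | 0, s => (s, false)
  | k + 1, s => if D s j then (s.ignite G j, true) else edgeLoop j k (s.burnEdge j)

/-- The outer loop of the burning algorithms, with an arbitrary decision `D`. -/
noncomputable def vertexLoop : List (NonRoot n) → BurnState n → BurnState n × Bool
  | [], s => (s, false)
  | j :: js, s =>
    let r := edgeLoop G D j (G.weight s(s.head, j.val) - s.burnt s(s.head, j.val)) s
    if r.2 then r else vertexLoop js r.1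

/-- The iterated step of the burning algorithms, with an arbitrary decision `D`. -/
noncomputable def machineStep (s : BurnState n) : BurnState n ⊕ BurnState n :=
  let r := vertexLoop G D (G.scanList s.burning) s
  if r.2 then Sum.inr r.1
  else if r.1.head ≠ 0 then Sum.inr r.1.back
  else Sum.inl r.1

variable {G D}

theorem mem_scanList (hV : G.verts = Finset.univ) {B : Finset (Fin (n + 1))} {j : NonRoot n} :
    j ∈ G.scanList B ↔ j.val ∉ B := by
  simp [scanList, hV]

/-- The counter `k` is exactly the number of unburnt copies, so each iteration is a legal step. A
break gives `TransGen`, at least one step, which is what makes the potential drop before the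
restart. -/
theorem edgeLoop_spec (j : NonRoot n) (k : ℕ) (s : BurnState n) (hj : j.val ∉ s.burning)
    (hk : s.burnt s(s.head, j.val) + k = G.weight s(s.head, j.val))
    (hfull : ∀ k : NonRoot n, j < k → k.val ∉ s.burning →
      s.burnt s(s.head, k.val) = G.weight s(s.head, k.val)) :
    ((edgeLoop G D j k s).2 = true → Relation.TransGen (G.Step D) s (edgeLoop G D j k s).1) ∧
    ((edgeLoop G D j k s).2 = false →
      Relation.ReflTransGen (G.Step D) s (edgeLoop G D j k s).1 ∧
      (edgeLoop G D j k s).1.head = s.head ∧ (edgeLoop G D j k s).1.burning = s.burning ∧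
      (edgeLoop G D j k s).1.burnt s(s.head, j.val) = G.weight s(s.head, j.val) ∧
      ∀ i : NonRoot n, i ≠ j →
        (edgeLoop G D j k s).1.burnt s(s.head, i.val) = s.burnt s(s.head, i.val)) := by
  induction k generalizing s with
  | zero =>
    simp only [edgeLoop, Bool.false_eq_true, false_imp_iff, true_imp_iff, true_and]
    exact ⟨Relation.ReflTransGen.refl, hk, fun _ _ => trivial⟩
  | succ k ih =>
    have hnext : G.IsNext s j := ⟨hj, by omega, hfull⟩
    by_cases hD : D s j
    · simp only [edgeLoop, if_pos hD, Bool.true_eq_false, false_imp_iff, true_imp_iff, and_true]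
      exact Relation.TransGen.single (Step.ignite s j hnext hD)
    · simp only [edgeLoop, if_neg hD]
      have hstep : G.Step D s (s.burnEdge j) := Step.burnEdge s j hnext hD
      have hb1 : (s.burnEdge j).burnt s(s.head, j.val) = s.burnt s(s.head, j.val) + 1 :=
        Function.update_self _ _ _
      have hb : ∀ i : NonRoot n, i ≠ j →
          (s.burnEdge j).burnt s(s.head, i.val) = s.burnt s(s.head, i.val) := fun i hi =>
        Function.update_of_ne (fun h => hi (NonRoot.val_injective (Sym2.congr_right.1 h))) _ _
      obtain ⟨h1, h2⟩ := ih (s.burnEdge j) hj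
        (by change (s.burnEdge j).burnt s(s.head, j.val) + k = G.weight s(s.head, j.val); omega)
        (fun i hi hiB => (hb i hi.ne').trans (hfull i hi hiB))
      refine ⟨fun h => Relation.TransGen.head hstep (h1 h), fun h => ?_⟩
      obtain ⟨h3, h4, h5, h6, h7⟩ := h2 h
      exact ⟨Relation.ReflTransGen.head hstep h3, h4, h5, h6,
        fun i hi => (h7 i hi).trans (hb i hi)⟩

theorem vertexLoop_spec (l : List (NonRoot n)) (s : BurnState n)
    (hle : ∀ j ∈ l, s.burnt s(s.head, j.val) ≤ G.weight s(s.head, j.val))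
    (hl : ∀ j ∈ l, j.val ∉ s.burning) (hsort : l.Pairwise (fun a b => b < a))
    (hfull : ∀ k : NonRoot n, k ∉ l → k.val ∉ s.burning →
      s.burnt s(s.head, k.val) = G.weight s(s.head, k.val)) :
    ((vertexLoop G D l s).2 = true → Relation.TransGen (G.Step D) s (vertexLoop G D l s).1) ∧
    ((vertexLoop G D l s).2 = false →
      Relation.ReflTransGen (G.Step D) s (vertexLoop G D l s).1 ∧
      G.Exhausted (vertexLoop G D l s).1) := by
  induction l generalizing s with
  | nil =>
    simp only [vertexLoop, Bool.false_eq_true, false_imp_iff, true_imp_iff, true_and]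
    exact ⟨Relation.ReflTransGen.refl, fun k hk => hfull k List.not_mem_nil hk⟩
  | cons j js ih =>
    rw [List.pairwise_cons] at hsort
    obtain ⟨h1, h2⟩ := edgeLoop_spec (D := D) j
      (G.weight s(s.head, j.val) - s.burnt s(s.head, j.val)) s (hl j List.mem_cons_self)
      (by have := hle j List.mem_cons_self; omega) (fun k hjk hk => hfull k (fun hmem => by
        rcases List.mem_cons.1 hmem with rfl | hmem
        · exact lt_irrefl _ hjk
        · exact lt_asymm hjk (hsort.1 k hmem)) hk)
    simp only [vertexLoop]
    set r := edgeLoop G D j (G.weight s(s.head, j.val) - s.burnt s(s.head, j.val)) s with hr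
    cases hb : r.2 with
    | true =>
      simp only [if_true, hb, Bool.true_eq_false, false_imp_iff, true_imp_iff, and_true]
      exact h1 hb
    | false =>
      obtain ⟨h3, h4, h5, h6, h7⟩ := h2 hb
      simp only [Bool.false_eq_true, if_false]
      have hne : ∀ k ∈ js, k ≠ j := fun k hk => (hsort.1 k hk).ne
      obtain ⟨h8, h9⟩ := ih r.1
        (fun k hk => by
          rw [h4, h7 k (hne k hk)]
          exact hle k (List.mem_cons_of_mem _ hk))
        (fun k hk => by
          rw [h5]
          exact hl k (List.mem_cons_of_mem _ hk)) hsort.2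
        (fun k hk hkB => by
          rw [h5] at hkB
          rw [h4]
          by_cases hkj : k = j
          · rw [hkj, h6]
          · rw [h7 k hkj]
            exact hfull k (fun h => (List.mem_cons.1 h).elim hkj hk) hkB)
      exact ⟨fun h => Relation.TransGen.trans_right h3 (h8 h),
        fun h => ⟨h3.trans (h9 h).1, (h9 h).2⟩⟩

variable {s : BurnState n} {f : Fin (n + 1) → Fin (n + 1)} {d : Fin (n + 1) → ℕ}

theorem Inv.vertexLoop_scanList (hV : G.verts = Finset.univ) (hs : G.Inv s f d) :
    ((vertexLoop G D (G.scanList s.burning) s).2 = true →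
      Relation.TransGen (G.Step D) s (vertexLoop G D (G.scanList s.burning) s).1) ∧
    ((vertexLoop G D (G.scanList s.burning) s).2 = false →
      Relation.ReflTransGen (G.Step D) s (vertexLoop G D (G.scanList s.burning) s).1 ∧
      G.Exhausted (vertexLoop G D (G.scanList s.burning) s).1) := by
  refine vertexLoop_spec _ s (fun _ _ => hs.burnt_le _) (fun j hj => (mem_scanList hV).1 hj) ?_
    (fun k hk hkB => absurd ((mem_scanList hV).2 hkB) hk)
  have h1 := Finset.pairwise_sort
    (Finset.univ.filter fun j : NonRoot n => j.val ∈ G.verts \ s.burning) (fun a b => b ≤ a)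
  have h2 := Finset.sort_nodup
    (Finset.univ.filter fun j : NonRoot n => j.val ∈ G.verts \ s.burning) (fun a b => b ≤ a)
  exact (h1.and h2).imp fun h => lt_of_le_of_ne h.1 h.2.symm

/-- A program `A` that simulates the machine with decision `D` halts, at the output of a terminal
state. -/
theorem exists_terminal (hV : G.verts = Finset.univ) {X β : Type*} (A : X → β ⊕ X)
    (R : BurnState n → X) (out : BurnState n → β) (J : BurnState n → Prop)
    (hJ : ∀ s t f d, G.Inv s f d → J s → G.Step D s t → J t)
    (hA : ∀ s f d, G.Inv s f d → J s →
      (∀ t, Relation.ReflTransGen (G.Step D) s t → J t) →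
      A (R s) = Sum.map out R (machineStep G D s))
    (hs : G.Inv s f d) (hJs : J s) :
    ∃ t f' d', Relation.ReflTransGen (G.Step D) s t ∧ G.Terminal t ∧ G.Inv t f' d' ∧ J t ∧
      out t ∈ PFun.fix (fun x => Part.some (A x)) (R s) := by
  -- `J` is tracked through single steps because one iteration of the program performs many of them.
  have hJ' : ∀ s f d, G.Inv s f d → J s → ∀ t, Relation.ReflTransGen (G.Step D) s t →
      (∃ f' d', G.Inv t f' d') ∧ J t := by
    intro s f d hs hJs t hst
    induction hst with
    | refl => exact ⟨⟨f, d, hs⟩, hJs⟩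
    | tail _ h ih =>
      obtain ⟨⟨f', d', hs'⟩, hJ'⟩ := ih
      obtain ⟨f'', d'', h', -⟩ := hs'.step hV h
      exact ⟨⟨f'', d'', h'⟩, hJ _ _ f' d' hs' hJ' h⟩
  induction hm : G.potential s d using Nat.strong_induction_on generalizing s f d with
  | _ m ih =>
    have hA' := hA s f d hs hJs fun t ht => (hJ' s f d hs hJs t ht).2
    obtain ⟨h1, h2⟩ := hs.vertexLoop_scanList (D := D) hV
    unfold machineStep at hA'
    set r := vertexLoop G D (G.scanList s.burning) s with hr
    have next : ∀ t, A (R s) = Sum.inr (R t) → Relation.TransGen (G.Step D) s t →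
        ∃ t f' d', Relation.ReflTransGen (G.Step D) s t ∧ G.Terminal t ∧ G.Inv t f' d' ∧ J t ∧
          out t ∈ PFun.fix (fun x => Part.some (A x)) (R s) := by
      intro t hAt hst
      obtain ⟨f', d', ht, hlt⟩ := hs.transGen_step hV hst
      obtain ⟨u, f'', d'', h3, h4, h5, h6, h7⟩ := ih _ (hm ▸ hlt) ht
        (hJ' s f d hs hJs t hst.to_reflTransGen).2 rfl
      refine ⟨u, f'', d'', hst.to_reflTransGen.trans h3, h4, h5, h6, ?_⟩
      exact PFun.mem_fix_iff.2 (Or.inr ⟨R t, by rw [hAt]; exact Part.mem_some _, h7⟩)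
    cases hb : r.2 with
    | true =>
      simp only [hb, if_true] at hA'
      exact next r.1 hA' (h1 hb)
    | false =>
      obtain ⟨h3, h4⟩ := h2 hb
      simp only [hb, Bool.false_eq_true, if_false] at hA'
      by_cases h0 : r.1.head = 0
      · rw [if_neg (not_not.2 h0)] at hA'
        obtain ⟨⟨f', d', h5⟩, h6⟩ := hJ' s f d hs hJs _ h3
        exact ⟨r.1, f', d', h3, ⟨h0, h4⟩, h5, h6,
          PFun.mem_fix_iff.2 (Or.inl (by rw [hA']; exact Part.mem_some _))⟩
      · rw [if_pos h0] at hA'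
        exact next r.1.back hA' (Relation.TransGen.tail' h3 (Step.back _ h0 h4))

end Loops

/-! ### The two programs as instances of the machine -/

section Simulation

variable {G : Multigraph n} [LinearOrder (NonRoot n)]

/-- In the burning algorithm on input `α`, an edge is burnt as long as chips are left. -/
def ByChips (α : NonRoot n → ℕ) (s : BurnState n) (j : NonRoot n) : Prop :=
  α j ≤ s.chips j

/-- The state of the burning algorithm on input `α`, whose variable `chips` counts the chips that
are left. -/
def BurnState.remaining (α : NonRoot n → ℕ) (s : BurnState n) : BurnState n :=
  { s with chips := fun j => α j - s.chips j }

theorem burnEdgeLoop_remaining (α : NonRoot n → ℕ) (j : NonRoot n) (k : ℕ) (s : BurnState n) :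
    burnEdgeLoop G j k (s.remaining α) =
      Prod.map (BurnState.remaining α) id (edgeLoop G (ByChips α) j k s) := by
  induction k generalizing s with
  | zero => rfl
  | succ k ih =>
    by_cases hD : α j ≤ s.chips j
    · have h1 : ¬ 1 ≤ (s.remaining α).chips j := by
        change ¬ 1 ≤ α j - s.chips j
        omega
      rw [burnEdgeLoop, if_neg h1, edgeLoop, if_pos (show ByChips α s j from hD)]
      rfl
    · have h1 : 1 ≤ (s.remaining α).chips j := by
        change 1 ≤ α j - s.chips j
        omega
      rw [burnEdgeLoop, if_pos h1, edgeLoop, if_neg (show ¬ ByChips α s j from hD), ← ih]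
      congr 1
      simp only [BurnState.remaining, BurnState.burnEdge, BurnState.mk.injEq, true_and]
      funext i
      by_cases hi : i = j
      · subst hi
        simp only [Function.update_self]
        omega
      · simp only [Function.update_of_ne hi]

theorem burnVertexLoop_remaining (α : NonRoot n → ℕ) (l : List (NonRoot n)) (s : BurnState n) :
    burnVertexLoop G l (s.remaining α) =
      Prod.map (BurnState.remaining α) id (vertexLoop G (ByChips α) l s) := by
  induction l generalizing s with
  | nil => rfl
  | cons j js ih =>
    have h1 := burnEdgeLoop_remaining (G := G) α j
      (G.weight s(s.head, j.val) - s.burnt s(s.head, j.val)) s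
    simp only [burnVertexLoop, vertexLoop]
    rw [show (s.remaining α).head = s.head from rfl,
      show (s.remaining α).burnt = s.burnt from rfl, h1]
    cases hb : (edgeLoop G (ByChips α) j
        (G.weight s(s.head, j.val) - s.burnt s(s.head, j.val)) s).2 with
    | true => simp [hb]
    | false => simp [hb, ih]

theorem burnStep_remaining (α : NonRoot n → ℕ) (s : BurnState n) :
    G.burnStep (s.remaining α) =
      Sum.map (fun s => (s.T, s.label)) (BurnState.remaining α)
        (machineStep G (ByChips α) s) := by
  simp only [burnStep, machineStep]
  rw [show (s.remaining α).burning = s.burning from rfl, burnVertexLoop_remaining]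
  set r := vertexLoop G (ByChips α) (G.scanList s.burning) s
  cases hb : r.2 with
  | true => simp [hb]
  | false =>
    by_cases h0 : r.1.head = 0
    · simp [hb, h0, BurnState.remaining]
    · simp [hb, h0, BurnState.remaining, BurnState.back]

/-- In the inverse algorithm on input `(T, ℓ)`, an edge is burnt unless it is an edge of `T` and
the number of unburnt copies is given by its label. -/
def ByTree (G T : Multigraph n) (l : Sym2 (Fin (n + 1)) → ℕ) (s : BurnState n) (j : NonRoot n) :
    Prop :=
  s(s.head, j.val) ∈ T.edges ∧
    l s(s.head, j.val) = G.weight s(s.head, j.val) - (s.burnt s(s.head, j.val) + 1)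

/-- The variables of the inverse algorithm. -/
def BurnState.toUnburn (s : BurnState n) : UnburnState n where
  burning := s.burning
  burnt := s.burnt
  chips := s.chips
  head := s.head

theorem unburnEdgeLoop_toUnburn (T : Multigraph n) (l : Sym2 (Fin (n + 1)) → ℕ) (j : NonRoot n)
    (k : ℕ) (s : BurnState n) :
    unburnEdgeLoop G T l j k s.toUnburn =
      Prod.map BurnState.toUnburn id (edgeLoop G (ByTree G T l) j k s) := by
  induction k generalizing s with
  | zero => rfl
  | succ k ih =>
    by_cases hD : ByTree G T l s j
    · rw [edgeLoop, if_pos hD, unburnEdgeLoop]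
      exact if_pos hD
    · rw [edgeLoop, if_neg hD, ← ih, unburnEdgeLoop]
      exact if_neg hD

theorem unburnVertexLoop_toUnburn (T : Multigraph n) (l : Sym2 (Fin (n + 1)) → ℕ)
    (js : List (NonRoot n)) (s : BurnState n) :
    unburnVertexLoop G T l js s.toUnburn =
      Prod.map BurnState.toUnburn id (vertexLoop G (ByTree G T l) js s) := by
  induction js generalizing s with
  | nil => rfl
  | cons j js ih =>
    have h1 := unburnEdgeLoop_toUnburn (G := G) T l j
      (G.weight s(s.head, j.val) - s.burnt s(s.head, j.val)) s
    simp only [unburnVertexLoop, vertexLoop]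
    rw [show s.toUnburn.head = s.head from rfl, show s.toUnburn.burnt = s.burnt from rfl, h1]
    cases hb : (edgeLoop G (ByTree G T l) j
        (G.weight s(s.head, j.val) - s.burnt s(s.head, j.val)) s).2 with
    | true => simp [hb]
    | false => simp [hb, ih]

/-- The inverse algorithm backtracks along the input tree, the machine along the tree built so far;
`hpar` asks that the two agree where it matters. -/
theorem unburnStep_toUnburn (T : Multigraph n) (l : Sym2 (Fin (n + 1)) → ℕ) (s : BurnState n)
    (hpar : (vertexLoop G (ByTree G T l) (G.scanList s.burning) s).2 = false →
      (vertexLoop G (ByTree G T l) (G.scanList s.burning) s).1.head ≠ 0 →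
      T.par (vertexLoop G (ByTree G T l) (G.scanList s.burning) s).1.head =
      (vertexLoop G (ByTree G T l) (G.scanList s.burning) s).1.T.par
        (vertexLoop G (ByTree G T l) (G.scanList s.burning) s).1.head) :
    G.unburnStep T l s.toUnburn =
      Sum.map BurnState.chips BurnState.toUnburn (machineStep G (ByTree G T l) s) := by
  simp only [unburnStep, machineStep]
  rw [show s.toUnburn.burning = s.burning from rfl, unburnVertexLoop_toUnburn]
  set r := vertexLoop G (ByTree G T l) (G.scanList s.burning) s
  cases hb : r.2 with
  | true => simp [hb]
  | false =>
    by_cases h0 : r.1.head = 0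
    · simp [hb, h0, BurnState.toUnburn]
    · simp [hb, h0, BurnState.toUnburn, BurnState.back, hpar hb h0]

end Simulation

/-! ### Replaying a run under another decision -/

/-- What the state `s` determines of a later state `t`. -/
structure Later (s t : BurnState n) : Prop where
  burning : s.burning ⊆ t.burning
  burnt_le : ∀ e, s.burnt e ≤ t.burnt e
  burnt_eq : ∀ a ∈ s.burning, ∀ b ∈ s.burning, t.burnt s(a, b) = s.burnt s(a, b)
  weight_le : ∀ e, s.T.weight e ≤ t.T.weight e
  chips_le : ∀ j, s.chips j ≤ t.chips j
  chips_eq : ∀ j : NonRoot n, j.val ∈ s.burning → t.chips j = s.chips j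

theorem Later.refl (s : BurnState n) : Later s s :=
  ⟨subset_rfl, fun _ => le_rfl, fun _ _ _ _ => rfl, fun _ => le_rfl, fun _ => le_rfl,
    fun _ _ => rfl⟩

theorem Later.trans {s t u : BurnState n} (h : Later s t) (h' : Later t u) : Later s u :=
  ⟨h.burning.trans h'.burning, fun e => (h.burnt_le e).trans (h'.burnt_le e),
    fun a ha b hb => (h'.burnt_eq a (h.burning ha) b (h.burning hb)).trans (h.burnt_eq a ha b hb),
    fun e => (h.weight_le e).trans (h'.weight_le e), fun j => (h.chips_le j).trans (h'.chips_le j),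
    fun j hj => (h'.chips_eq j (h.burning hj)).trans (h.chips_eq j hj)⟩

section Later

variable {G : Multigraph n} [LinearOrder (NonRoot n)] {D : BurnState n → NonRoot n → Prop}

theorem Step.later {s t : BurnState n} (h : G.Step D s t) : Later s t := by
  cases h with
  | burnEdge j hj hD =>
    refine ⟨subset_rfl, fun e => ?_, fun a ha b hb => ?_, fun _ => le_rfl, fun k => ?_,
      fun k hk => ?_⟩
    · change s.burnt e ≤ Function.update s.burnt s(s.head, j.val) (s.burnt s(s.head, j.val) + 1) e
      by_cases he : e = s(s.head, j.val)
      · rw [he, Function.update_self]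
        exact Nat.le_succ _
      · rw [Function.update_of_ne he]
    · refine Function.update_of_ne (fun h => ?_) _ _
      rcases Sym2.eq_iff.1 h with ⟨-, h⟩ | ⟨h, -⟩
      · exact hj.1 (h ▸ hb)
      · exact hj.1 (h ▸ ha)
    · change s.chips k ≤ Function.update s.chips j (s.chips j + 1) k
      by_cases hk : k = j
      · rw [hk, Function.update_self]
        exact Nat.le_succ _
      · rw [Function.update_of_ne hk]
    · exact Function.update_of_ne (fun h => hj.1 (by rwa [← h])) _ _
  | ignite j hj hD =>
    exact ⟨Finset.subset_insert _ _, fun _ => le_rfl, fun _ _ _ _ => rfl,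
      fun _ => Nat.le_add_right _ _, fun _ => le_rfl, fun _ _ => rfl⟩
  | back h0 h =>
    exact ⟨subset_rfl, fun _ => le_rfl, fun _ _ _ _ => rfl, fun _ => le_rfl, fun _ => le_rfl,
      fun _ _ => rfl⟩

theorem later_of_steps {s t : BurnState n} (h : Relation.ReflTransGen (G.Step D) s t) :
    Later s t := by
  induction h with
  | refl => exact Later.refl s
  | tail _ h ih => exact ih.trans h.later

variable {s t : BurnState n} {f : Fin (n + 1) → Fin (n + 1)} {d : Fin (n + 1) → ℕ}

/-- A run of the burning algorithm is a run of the inverse algorithm on its final tree. -/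
theorem steps_byTree (hV : G.verts = Finset.univ) (ht : G.Inv t f d)
    {f₀ : Fin (n + 1) → Fin (n + 1)} {d₀ : Fin (n + 1) → ℕ} (hs : G.Inv s f₀ d₀)
    (hst : Relation.ReflTransGen (G.Step D) s t) :
    Relation.ReflTransGen (G.Step (ByTree G t.T t.label)) s t := by
  have hlabel : ∀ e, t.T.weight e ≠ 0 → t.burnt e < G.weight e ∧
      t.label e = G.weight e - (t.burnt e + 1) := by
    intro e he
    obtain ⟨v, hv, h0, rfl⟩ := ht.tree.weight_ne_zero.1 he
    exact ht.tree_burnt v (ht.verts ▸ hv) h0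
  induction hst using Relation.ReflTransGen.head_induction_on generalizing f₀ d₀ with
  | refl => exact Relation.ReflTransGen.refl
  | @head s u hsu hut ih =>
    obtain ⟨f₁, d₁, hu, -⟩ := hs.step hV hsu
    refine Relation.ReflTransGen.head ?_ (ih hu)
    have hlater := later_of_steps hut
    cases hsu with
    | burnEdge j hj hD =>
      refine Step.burnEdge s j hj ?_
      -- A premature ignition would match the label at the current count, but the label belongs to
      -- the final count, which is strictly larger.
      rintro ⟨he, hl⟩
      have h1 := hlabel _ (Finset.mem_filter.1 he).2
      have h2 := hlater.burnt_le s(s.head, j.val)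
      have h3 : (s.burnEdge j).burnt s(s.head, j.val) = s.burnt s(s.head, j.val) + 1 :=
        Function.update_self _ _ _
      omega
    | ignite j hj hD =>
      refine Step.ignite s j hj ?_
      have hw : t.T.weight s(s.head, j.val) ≠ 0 := by
        have h1 := hlater.weight_le s(s.head, j.val)
        have h2 : (s.ignite G j).T.weight s(s.head, j.val) = s.T.weight s(s.head, j.val) + 1 := by
          change s.T.weight _ + (if _ then 1 else 0) = _
          rw [if_pos ⟨rfl, ne_of_mem_of_not_mem hs.head_mem hj.1⟩]
        omega
      refine ⟨Finset.mem_filter.2 ⟨Finset.mem_univ _, hw⟩, ?_⟩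
      -- Both ends burn from now on, so the count that defines the final label is the present one.
      rw [(hlabel _ hw).2, hlater.burnt_eq s.head (Finset.mem_insert_of_mem hs.head_mem) j.val
        (Finset.mem_insert_self _ _)]
      rfl
    | back h0 h => exact Step.back s h0 h

/-- A run of depth-first burning is a run of the burning algorithm on the numbers of burnt
edges. -/
theorem steps_byChips (hst : Relation.ReflTransGen (G.Step D) s t) :
    Relation.ReflTransGen (G.Step (ByChips t.chips)) s t := by
  induction hst using Relation.ReflTransGen.head_induction_on with
  | refl => exact Relation.ReflTransGen.refl
  | @head s u hsu hut ih =>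
    refine Relation.ReflTransGen.head ?_ ih
    have hlater := later_of_steps hut
    cases hsu with
    | burnEdge j hj hD =>
      refine Step.burnEdge s j hj ?_
      have h1 := hlater.chips_le j
      have h2 : (s.burnEdge j).chips j = s.chips j + 1 := Function.update_self _ _ _
      intro h
      have : t.chips j ≤ s.chips j := h
      omega
    | ignite j hj hD =>
      exact Step.ignite s j hj (hlater.chips_eq j (Finset.mem_insert_self _ _)).le
    | back h0 h => exact Step.back s h0 h

end Later

/-! ### Terminal states of the two algorithms -/

section Runs

variable {G : Multigraph n} [LinearOrder (NonRoot n)]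
variable {s t : BurnState n} {f : Fin (n + 1) → Fin (n + 1)} {d : Fin (n + 1) → ℕ}

theorem Inv.burnt_eq_of_terminal (hs : G.Inv s f d) (ht : G.Terminal s) {v w : Fin (n + 1)}
    (hv : v ∈ s.burning) (hw : w ∉ s.burning) : s.burnt s(v, w) = G.weight s(v, w) := by
  by_cases h0 : v = 0
  · obtain ⟨k, rfl⟩ := NonRoot.exists_val (fun h => hw (h ▸ hs.zero_mem) : w ≠ 0)
    rw [h0, ← ht.1]
    exact ht.2 k hw
  · exact hs.done v hv (fun h => h0 (by rw [ht.1] at h; exact h.eq_zero)) w hw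

theorem exists_burn (hV : G.verts = Finset.univ) (α : NonRoot n → ℕ) :
    ∃ t f d, Relation.ReflTransGen (G.Step (ByChips α)) (burnInit fun _ => 0) t ∧ G.Terminal t ∧
      G.Inv t f d ∧ (∀ j, t.chips j ≤ α j ∧ (j.val ∈ t.burning → t.chips j = α j)) ∧
      (t.T, t.label) ∈ G.dfsBurn α := by
  -- With no edge burnt, `α j - 0` chips remain, so the zero count represents the initial state on
  -- input `α`.
  refine exists_terminal hV G.burnStep (BurnState.remaining α) (fun t => (t.T, t.label))
    (fun t => ∀ j, t.chips j ≤ α j ∧ (j.val ∈ t.burning → t.chips j = α j)) ?_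
    (fun s f d _ _ _ => burnStep_remaining α s) (inv_init G) ?_
  · intro s t f d hs hJ hst
    cases hst with
    | burnEdge j hj hD =>
      intro k
      by_cases hk : k = j
      · subst hk
        have h1 : (s.burnEdge k).chips k = s.chips k + 1 := Function.update_self _ _ _
        refine ⟨?_, fun h => absurd h hj.1⟩
        have : ¬ α k ≤ s.chips k := hD
        omega
      · have h1 : (s.burnEdge j).chips k = s.chips k := Function.update_of_ne hk _ _
        rw [h1]
        exact hJ k
    | ignite j hj hD =>
      intro k
      refine ⟨(hJ k).1, fun h => ?_⟩
      rcases Finset.mem_insert.1 h with h | h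
      · obtain rfl := NonRoot.val_injective h
        exact le_antisymm (hJ k).1 hD
      · exact (hJ k).2 h
    | back h0 h => exact hJ
  · exact fun j => ⟨Nat.zero_le _, fun h => absurd (Finset.mem_singleton.1 h) j.val_ne_zero⟩

theorem Inv.deg_le_chips (hV : G.verts = Finset.univ) (hs : G.Inv s f d) (ht : G.Terminal s)
    {j : NonRoot n} (hj : j.val ∉ s.burning) : G.deg (G.verts \ s.burning) j.val ≤ s.chips j := by
  rw [deg, hV, sdiff_sdiff_right_self, hs.chips_out j hj]
  refine (Finset.sum_le_sum fun v hv => ?_).trans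
    (Finset.sum_le_sum_of_subset (Finset.subset_univ (Finset.univ ⊓ s.burning)))
  have hv : v ∈ s.burning := (Finset.mem_inter.1 hv).2
  rw [Sym2.eq_swap, hs.burnt_eq_of_terminal ht hv hj]

theorem Inv.mem_labeledSpanningTrees (hs : G.Inv s f d) (hV : s.T.verts = G.verts) :
    (s.T, s.label) ∈ G.labeledSpanningTrees := by
  have hpos : ∀ e, s.T.weight e ≠ 0 → s.label e < G.weight e := by
    intro e he
    obtain ⟨v, hv, h0, rfl⟩ := hs.tree.weight_ne_zero.1 he
    have := hs.tree_burnt v (hs.verts ▸ hv) h0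
    omega
  refine ⟨⟨hV, fun e => ?_, hs.tree.isTree⟩, fun e he => hpos e (Finset.mem_filter.1 he).2,
    fun e he => hs.label_out e ?_⟩
  · by_cases he : s.T.weight e = 0
    · exact he.le.trans (Nat.zero_le _)
    · have h1 := hs.tree.weight_of_mem_edges (Finset.mem_filter.2 ⟨Finset.mem_univ _, he⟩)
      have h2 := hpos e he
      change s.T.weight e ≤ _
      rw [h1]
      exact (Nat.zero_le _).trans_lt h2
  · by_contra h
    exact he (Finset.mem_filter.2 ⟨Finset.mem_univ _, h⟩)

/-- The invariants of the inverse algorithm on input `(T, ℓ)`. -/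
structure TreeInv (G T : Multigraph n) (l : Sym2 (Fin (n + 1)) → ℕ) (s : BurnState n) : Prop where
  sub : ∀ e, s.T.weight e ≠ 0 → T.weight e ≠ 0
  label : ∀ e, s.T.weight e ≠ 0 → s.label e = l e
  -- The copy whose turn matches the label has not yet been passed over.
  bound : ∀ v ∈ s.burning, ∀ w ∉ s.burning, T.weight s(v, w) ≠ 0 →
    l s(v, w) < G.weight s(v, w) - s.burnt s(v, w)

theorem TreeInv.step {T : Multigraph n} {l : Sym2 (Fin (n + 1)) → ℕ}
    (hl : ∀ e ∈ T.edges, l e < G.weight e) (hs : G.Inv s f d) (hJ : TreeInv G T l s)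
    (hst : G.Step (ByTree G T l) s t) : TreeInv G T l t := by
  cases hst with
  | burnEdge j hj hD =>
    refine ⟨hJ.sub, hJ.label, fun v hv w hw hvw => ?_⟩
    have h1 := hJ.bound v hv w hw hvw
    by_cases he : s(v, w) = s(s.head, j.val)
    · rw [he] at h1 hvw ⊢
      have h2 : (s.burnEdge j).burnt s(s.head, j.val) = s.burnt s(s.head, j.val) + 1 :=
        Function.update_self _ _ _
      have h3 : l s(s.head, j.val) ≠ G.weight s(s.head, j.val) - (s.burnt s(s.head, j.val) + 1) :=
        fun h => hD ⟨Finset.mem_filter.2 ⟨Finset.mem_univ _, hvw⟩, h⟩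
      omega
    · have h2 : (s.burnEdge j).burnt s(v, w) = s.burnt s(v, w) := Function.update_of_ne he _ _
      rwa [h2]
  | ignite j hj hD =>
    have hold : ∀ e, e ≠ s(s.head, j.val) → (s.ignite G j).T.weight e = s.T.weight e ∧
        (s.ignite G j).label e = s.label e := by
      intro e he
      refine ⟨?_, Function.update_of_ne he _ _⟩
      change s.T.weight e + (if _ then 1 else 0) = _
      rw [if_neg fun h => he h.1, add_zero]
    refine ⟨fun e he => ?_, fun e he => ?_, fun v hv w hw hvw => ?_⟩
    · by_cases hej : e = s(s.head, j.val)
      · rw [hej]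
        exact (Finset.mem_filter.1 hD.1).2
      · exact hJ.sub e (by rwa [← (hold e hej).1])
    · by_cases hej : e = s(s.head, j.val)
      · rw [hej, hD.2]
        exact Function.update_self _ _ _
      · rw [(hold e hej).2]
        exact hJ.label e (by rwa [← (hold e hej).1])
    · have hw' : w ∉ s.burning := fun h => hw (Finset.mem_insert_of_mem h)
      rcases Finset.mem_insert.1 hv with rfl | hv
      · have h1 : (s.ignite G j).burnt s(j.val, w) = 0 := hs.burnt_out _ _ hj.1 hw'
        rw [h1]
        exact hl _ (Finset.mem_filter.2 ⟨Finset.mem_univ _, hvw⟩)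
      · exact hJ.bound v hv w hw' hvw
  | back h0 h => exact ⟨hJ.sub, hJ.label, hJ.bound⟩

theorem exists_unburn (hV : G.verts = Finset.univ) {T : Multigraph n}
    {l : Sym2 (Fin (n + 1)) → ℕ} (hp : (T, l) ∈ G.labeledSpanningTrees) :
    ∃ t f d, Relation.ReflTransGen (G.Step (ByTree G T l)) (burnInit fun _ => 0) t ∧
      G.Terminal t ∧ G.Inv t f d ∧ TreeInv G T l t ∧ t.chips ∈ G.dfsUnburn (T, l) := by
  obtain ⟨⟨hTV, hTG, hT⟩, hl, hl0⟩ := hp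
  replace hTV : T.verts = Finset.univ := hTV.trans hV
  obtain ⟨F, dF, hF⟩ := hT.exists_isParentMap hTV
  refine exists_terminal hV (G.unburnStep T l) BurnState.toUnburn BurnState.chips
    (TreeInv G T l) (fun s t f d hs hJ hst => hJ.step hl hs hst) ?_ (inv_init G) ?_
  · intro s f d hs hJ hJt
    refine unburnStep_toUnburn T l s fun hb h0 => ?_
    have hst := ((hs.vertexLoop_scanList hV).2 hb).1
    obtain ⟨f', d', ht⟩ := hs.steps hV hst
    rw [hF.par_eq (hTV ▸ Finset.mem_univ _) h0, ht.par_head h0]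
    exact (ht.tree.parent_eq_of_le hF (hJt _ hst).sub (ht.verts ▸ ht.head_mem) h0).symm
  · exact ⟨fun e he => absurd rfl he, fun e he => absurd rfl he, fun v hv w hw hvw =>
      hl _ (Finset.mem_filter.2 ⟨Finset.mem_univ _, hvw⟩)⟩

/-- If some vertex did not burn, connectedness would give an edge of `T` leaving `burning`; it is
entirely burnt, against `bound`. So the tree built spans, lies in `T`, and has as many edges as `T`.
-/
theorem TreeInv.eq_of_terminal (hV : G.verts = Finset.univ) {T : Multigraph n}
    {l : Sym2 (Fin (n + 1)) → ℕ} (hp : (T, l) ∈ G.labeledSpanningTrees) (hs : G.Inv s f d)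
    (hJ : TreeInv G T l s) (ht : G.Terminal s) : s.T = T ∧ s.label = l := by
  obtain ⟨⟨hTV, hTG, hT⟩, hl, hl0⟩ := hp
  replace hTV : T.verts = Finset.univ := hTV.trans hV
  have hB : s.burning = Finset.univ := by
    by_contra hne
    obtain ⟨i, hi, hdeg⟩ := hT.1 (s.burningᶜ)
      (Finset.nonempty_iff_ne_empty.2 fun h => hne (Finset.compl_eq_empty_iff _ |>.1 h))
      (by rw [show T.verts = Finset.univ from hTV]; exact Finset.subset_univ _)
      (fun h => Finset.mem_compl.1 h hs.zero_mem)
    obtain ⟨j, hj, hij⟩ := Finset.exists_ne_zero_of_sum_ne_zero (Nat.one_le_iff_ne_zero.1 hdeg)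
    have hj : j ∈ s.burning := by
      by_contra h
      exact (Finset.mem_sdiff.1 hj).2 (Finset.mem_compl.2 h)
    have h1 := hJ.bound j hj i (Finset.mem_compl.1 hi) (by rwa [Sym2.eq_swap])
    rw [hs.burnt_eq_of_terminal ht hj (Finset.mem_compl.1 hi)] at h1
    omega
  have hsV : s.T.verts = T.verts := by rw [hs.verts, hB, hTV]
  have hle : ∀ e ∈ Finset.univ, s.T.weight e ≤ T.weight e := by
    intro e _
    by_cases he : s.T.weight e = 0
    · omega
    · have h1 := hs.tree.weight_of_mem_edges (Finset.mem_filter.2 ⟨Finset.mem_univ _, he⟩)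
      have h2 := hJ.sub e he
      omega
  have hw : s.T.weight = T.weight := by
    funext e
    refine (Finset.sum_eq_sum_iff_of_le hle).1 ?_ e (Finset.mem_univ _)
    have h1 := hs.tree.isTree.2
    have h2 : T.numEdges + 1 = T.verts.card := hT.2
    rw [hsV, ← h2] at h1
    exact Nat.succ_injective h1
  refine ⟨Multigraph.ext hsV hw, funext fun e => ?_⟩
  by_cases he : s.T.weight e = 0
  · exact (hs.label_out e he).trans (hl0 e fun h => (Finset.mem_filter.1 h).2 (hw ▸ he)).symm
  · exact hJ.label e he

end Runs

/-! ### Counting unburnt edges -/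

section Kappa

variable {G : Multigraph n} [LinearOrder (NonRoot n)]
variable {s : BurnState n} {f : Fin (n + 1) → Fin (n + 1)} {d : Fin (n + 1) → ℕ}

theorem Inv.kappa_eq (hs : G.Inv s f d) (hB : s.burning = Finset.univ) :
    G.kappa s.T = ∑ e with e ∉ s.T.edges, (G.weight e - s.burnt e) := by
  classical
  have hmB : ∀ v, v ∈ s.burning := fun v => hB ▸ Finset.mem_univ v
  have hm : ∀ v, v ∈ s.T.verts := fun v => hs.verts ▸ hmB v
  have hdep : ∀ {i : NonRoot n} {v}, Anc f i.val v → d (f i.val) < d v := fun {i v} h =>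
    (hs.tree.depth _ (hm _) i.val_ne_zero).trans_le (hs.tree.anc_depth (hm _) h)
  have hP : G.kappa s.T = ∑ p : NonRoot n × NonRoot n with Anc f p.1.val p.2.val ∧ p.2 < p.1,
      G.weight s(f p.1.val, p.2.val) := by
    rw [kappa]
    refine Finset.sum_congr ?_ fun p _ => by rw [hs.tree.par_eq (hm _) p.1.val_ne_zero]
    ext p
    rw [Finset.mem_filter, Finset.mem_filter, hs.tree.treeLE_iff (hm _)]
  rw [hP]
  have hnot : ∀ i j : NonRoot n, Anc f i.val j.val → j < i →
      s(f i.val, j.val) ∉ s.T.edges := by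
    intro i j hij hlt he
    have h1 := hdep hij
    rcases hs.tree.adj (Finset.mem_filter.1 he).2 with ⟨-, h0, h⟩ | ⟨-, h0, h⟩
    · have := hs.tree.depth (f i.val) (hm _) h0
      rw [← h] at this
      omega
    · rcases hij.eq_or_parent with h2 | h2
      · exact hlt.ne (NonRoot.val_injective h2.symm)
      · have := hdep h2.2
        rw [h] at this
        exact lt_irrefl _ this
  -- The pair `(i, j)` can be recovered from its edge: `j` is the deeper end, and `i` is the child
  -- of the other end towards `j`. Non-tree edges outside the image have no unburnt copies.
  refine Finset.sum_of_injOn (fun p => s(f p.1.val, p.2.val)) ?_ ?_ ?_ ?_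
  · rintro ⟨i, j⟩ hp ⟨i', j'⟩ hp' h
    obtain ⟨-, hij, -⟩ := Finset.mem_filter.1 hp
    obtain ⟨-, hij', -⟩ := Finset.mem_filter.1 hp'
    dsimp only at hij hij' h
    rcases Sym2.eq_iff.1 h with ⟨h1, h2⟩ | ⟨h1, h2⟩
    · obtain rfl := NonRoot.val_injective h2
      have key : ∀ {a b : NonRoot n}, Anc f a.val b.val → f a.val = f b.val → a = b := by
        intro a b hab h
        rcases hab.eq_or_parent with h2 | h2
        · exact NonRoot.val_injective h2
        · have := hdep h2.2
          rw [h] at this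
          exact absurd this (lt_irrefl _)
      rcases hij.total hij' with h | h
      · rw [key h h1]
      · rw [key h h1.symm]
    · have h3 := hdep hij
      have h4 := hdep hij'
      rw [h2] at h3
      rw [← h1] at h4
      omega
  · rintro ⟨i, j⟩ hp
    obtain ⟨-, hij, hlt⟩ := Finset.mem_filter.1 hp
    exact Finset.mem_coe.2 (Finset.mem_filter.2 ⟨Finset.mem_univ _, hnot i j hij hlt⟩)
  · intro e he hne
    replace he := (Finset.mem_filter.1 he).2
    have key : ∀ v w, v ≠ w → Anc f v w → e = s(v, w) → s.burnt e = G.weight e := by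
      rintro v w hvw h rfl
      rcases h.eq_or_child with h | ⟨k, hk0, rfl, hk⟩
      · exact absurd h hvw
      · obtain ⟨i, rfl⟩ := NonRoot.exists_val hk0
        have hw0 : w ≠ 0 := by
          rintro rfl
          exact hk0 hk.eq_zero
        obtain ⟨j, rfl⟩ := NonRoot.exists_val hw0
        rcases lt_trichotomy i j with h | h | h
        · exact (hs.comparable i j (hmB _) hk).1 h
        · subst h
          refine absurd (Finset.mem_filter.2 ⟨Finset.mem_univ _, ?_⟩) he
          rw [Sym2.eq_swap, hs.tree.weight_parent (hm _) hk0]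
          exact one_ne_zero
        · exact absurd ⟨(i, j), Finset.mem_coe.2 (Finset.mem_filter.2
            ⟨Finset.mem_univ _, hk, h⟩), rfl⟩ hne
    have hfull : s.burnt e = G.weight e := by
      induction e with
      | _ v w =>
        by_cases hvw : v = w
        · subst hvw
          have := hs.burnt_le s(v, v)
          rw [G.loopless] at this ⊢
          omega
        · by_cases h1 : Anc f v w
          · exact key v w hvw h1 rfl
          · by_cases h2 : Anc f w v
            · exact key w v (Ne.symm hvw) h2 Sym2.eq_swap
            · exact hs.incomparable v (hmB v) w (hmB w) h1 h2
    omega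
  · rintro ⟨i, j⟩ hp
    obtain ⟨-, hij, hlt⟩ := Finset.mem_filter.1 hp
    dsimp only at hij hlt ⊢
    rw [(hs.comparable i j (hmB _) hij).2 hlt, Nat.sub_zero]

theorem Inv.rsum_eq (hs : G.Inv s f d) (hB : s.burning = Finset.univ) :
    G.rsum s.chips = ((G.kappa s.T + ∑ e ∈ s.T.edges, s.label e : ℕ) : ℤ) := by
  have h1 : ∑ e, (G.weight e - s.burnt e) + ∑ j, s.chips j = G.numEdges := by
    rw [hs.chips_sum, ← Finset.sum_add_distrib, numEdges]
    exact Finset.sum_congr rfl fun e _ => Nat.sub_add_cancel (hs.burnt_le e)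
  -- The igniting copy of each tree edge is unburnt but not counted by the label; these `n` copies
  -- cancel the `n` in `rsum`.
  have h2 : ∑ e ∈ s.T.edges, (G.weight e - s.burnt e) = ∑ e ∈ s.T.edges, s.label e + n := by
    have hcard : s.T.edges.card = n := by
      have := hs.tree.card_edges
      rw [hs.verts, hB, Finset.card_univ, Fintype.card_fin] at this
      omega
    refine Eq.trans ?_ (congrArg (∑ e ∈ s.T.edges, s.label e + ·) hcard)
    rw [Finset.card_eq_sum_ones, ← Finset.sum_add_distrib]
    refine Finset.sum_congr rfl fun e he => ?_
    obtain ⟨v, hv, h0, rfl⟩ := hs.tree.weight_ne_zero.1 (Finset.mem_filter.1 he).2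
    have := hs.tree_burnt v (hs.verts ▸ hv) h0
    omega
  have h3 : ∑ e, (G.weight e - s.burnt e) = ∑ e ∈ s.T.edges, (G.weight e - s.burnt e) +
      ∑ e with e ∉ s.T.edges, (G.weight e - s.burnt e) := by
    rw [← Finset.sum_filter_add_sum_filter_not Finset.univ (· ∈ s.T.edges)]
    congr 2
    ext e
    simp
  rw [rsum, ← Nat.cast_sum, ← h1, h3, h2, ← hs.kappa_eq hB]
  push_cast
  ring

end Kappa

/-! ### The bijection -/

section Main

variable {G : Multigraph n} [LinearOrder (NonRoot n)]

theorem exists_mem_dfsBurn (hV : G.verts = Finset.univ) (α : NonRoot n → ℕ) :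
    ∃ (T : Multigraph n) (l : Sym2 (Fin (n + 1)) → ℕ), (T, l) ∈ G.dfsBurn α ∧
      (T.verts = G.verts → α ∈ G.PF ∧ (T, l) ∈ G.labeledSpanningTrees ∧
        α ∈ G.dfsUnburn (T, l) ∧ G.rsum α = ((G.kappa T + ∑ e ∈ T.edges, l e : ℕ) : ℤ)) ∧
      (T.verts ≠ G.verts →
        (G.verts \ T.verts).Nonempty ∧
        (∀ j : NonRoot n, j.val ∈ G.verts \ T.verts → G.deg (G.verts \ T.verts) j.val ≤ α j) ∧
        α ∉ G.PF) := by
  obtain ⟨t, f, d, hst, hterm, ht, hchips, hmem⟩ := exists_burn hV α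
  refine ⟨t.T, t.label, hmem, fun hTV => ?_, fun hTV => ?_⟩
  · have hB : t.burning = Finset.univ := by rw [← ht.verts, hTV, hV]
    have hα : t.chips = α := funext fun j => (hchips j).2 (hB ▸ Finset.mem_univ _)
    have hp := ht.mem_labeledSpanningTrees hTV
    refine ⟨fun U hU _ h0 => ?_, hp, ?_, hα ▸ ht.rsum_eq hB⟩
    · obtain ⟨v, hv⟩ := hU
      obtain ⟨i, hiU, -, hi⟩ := ht.parking U h0 ⟨v, hv, hB ▸ Finset.mem_univ v⟩
      exact ⟨i, hiU, hα ▸ hi⟩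
    · obtain ⟨u, f', d', hsu, huterm, -, -, hu⟩ := exists_unburn hV hp
      -- The burning run, replayed under its own output, must end where the inverse algorithm ends.
      have := huterm.unique hterm hsu (steps_byTree hV ht (inv_init G) hst)
      rwa [this, hα] at hu
  · have hne : (G.verts \ t.T.verts).Nonempty := by
      rw [hV] at hTV ⊢
      rw [Finset.sdiff_nonempty]
      exact fun h => hTV (Finset.univ_subset_iff.1 h)
    have hdeg : ∀ j : NonRoot n, j.val ∈ G.verts \ t.T.verts →
        G.deg (G.verts \ t.T.verts) j.val ≤ α j := by
      intro j hj
      rw [ht.verts] at hj ⊢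
      exact (ht.deg_le_chips hV hterm (Finset.mem_sdiff.1 hj).2).trans (hchips j).1
    refine ⟨hne, hdeg, fun hα => ?_⟩
    obtain ⟨i, hi, hle⟩ := hα _ hne Finset.sdiff_subset
      fun h => (Finset.mem_sdiff.1 h).2 t.T.root_mem
    have := hdeg i hi
    omega

theorem exists_dfsBurn_eq (hV : G.verts = Finset.univ)
    {p : Multigraph n × (Sym2 (Fin (n + 1)) → ℕ)} (hp : p ∈ G.labeledSpanningTrees) :
    ∃ α, p ∈ G.dfsBurn α := by
  obtain ⟨T, l⟩ := p
  obtain ⟨t, f, d, hst, hterm, ht, hJ, -⟩ := exists_unburn hV hp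
  obtain ⟨u, f', d', hsu, huterm, -, -, hu⟩ := exists_burn hV t.chips
  obtain ⟨rfl, rfl⟩ := hJ.eq_of_terminal hV hp ht hterm
  have := huterm.unique hterm hsu (steps_byChips hst)
  exact ⟨t.chips, this ▸ hu⟩

end Main

end Multigraph

theorem mainTheorem3 (n : ℕ) (G : Multigraph n) (hV : G.verts = Finset.univ)
    (hG : G.Connected) [LinearOrder (NonRoot n)] :
    (∀ α : NonRoot n → ℕ, ∃ (T : Multigraph n) (l : Sym2 (Fin (n + 1)) → ℕ),
      (T, l) ∈ G.dfsBurn α ∧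
      (T.verts = G.verts → α ∈ G.PF) ∧
      (T.verts ≠ G.verts →
        (G.verts \ T.verts).Nonempty ∧
        (∀ j : NonRoot n, j.val ∈ G.verts \ T.verts → G.deg (G.verts \ T.verts) j.val ≤ α j) ∧
        α ∉ G.PF)) ∧
    ∃ φ : G.PF ≃ G.labeledSpanningTrees,
      (∀ α : G.PF, (φ α : Multigraph n × (Sym2 (Fin (n + 1)) → ℕ)) ∈ G.dfsBurn α) ∧
      (∀ (α : G.PF) (T : Multigraph n) (l : Sym2 (Fin (n + 1)) → ℕ),
        (φ α : Multigraph n × (Sym2 (Fin (n + 1)) → ℕ)) = (T, l) →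
          G.rsum α = ((G.kappa T + ∑ e ∈ T.edges, l e : ℕ) : ℤ)) ∧
      (∀ p : G.labeledSpanningTrees, (φ.symm p : NonRoot n → ℕ) ∈ G.dfsUnburn p) := by
  have hburn := G.exists_mem_dfsBurn hV
  refine ⟨fun α => ?_, ?_⟩
  · obtain ⟨T, l, h1, h2, h3⟩ := hburn α
    exact ⟨T, l, h1, fun h => (h2 h).1, h3⟩
  · have hout : ∀ α : G.PF, ∃ p : G.labeledSpanningTrees, p.1 ∈ G.dfsBurn α ∧
        α.1 ∈ G.dfsUnburn p ∧
        G.rsum α = ((G.kappa p.1.1 + ∑ e ∈ p.1.1.edges, p.1.2 e : ℕ) : ℤ) := by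
      intro α
      obtain ⟨T, l, h1, h2, h3⟩ := hburn α
      obtain ⟨-, h4, h5, h6⟩ := h2 (by_contra fun h => (h3 h).2.2 α.2)
      exact ⟨⟨(T, l), h4⟩, h1, h5, h6⟩
    choose φ hφ1 hφ2 hφ3 using hout
    have hbij : Function.Bijective φ := by
      -- Injectivity holds because the inverse algorithm has only one output. For surjectivity, the
      -- preimage is a parking function since the tree of `p` spans.
      refine ⟨fun α β h => Subtype.ext (Part.mem_unique (hφ2 α) (h ▸ hφ2 β)), fun p => ?_⟩
      obtain ⟨α, hα⟩ := G.exists_dfsBurn_eq hV p.2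
      obtain ⟨T, l, h1, h2, -⟩ := hburn α
      have hp : p.1 = (T, l) := Part.mem_unique hα h1
      have hTV : T.verts = G.verts := by
        have := p.2.1.1
        rwa [hp] at this
      exact ⟨⟨α, (h2 hTV).1⟩, Subtype.ext (Part.mem_unique (hφ1 _) hα)⟩
    refine ⟨Equiv.ofBijective φ hbij, hφ1, fun α T l h => ?_, fun p => ?_⟩
    · have h' : (φ α).1 = (T, l) := h
      have := hφ3 α
      rwa [h'] at this
    · obtain ⟨α, rfl⟩ := hbij.2 p
      rw [Equiv.ofBijective_symm_apply_apply]
      exact hφ2 α
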